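/- Let $D$ be a finite simple digraph (no loops and no multiple arcs; opposite arcs $u\to v$ and $v\to u$ are allowed) on $n > 2$ vertices. Suppose that $D$ is strongly connected and that every vertex $u$ satisfies $d^+(u) > \frac{n}{2}$ and $d^-(u) > \frac{n}{2}$, where $d^+(u)$ and $d^-(u)$ denote the out-degree and the in-degree of $u$. Then $D$ contains two arc-disjoint Hamiltonian cycles, that is, two directed cycles, each passing through every vertex of $D$ exactly once, that have no arc in common. -/

import Mathlib

namespace Digraph

variable {V : Type*}

/-- The out-degree of `u`: the number of arcs `u → v`. -/
noncomputable def outDeg (D : Digraph V) (u : V) : ℕ := {v : V | D.Adj u v}.ncard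

/-- The in-degree of `u`: the number of arcs `v → u`. -/
noncomputable def inDeg (D : Digraph V) (u : V) : ℕ := {v : V | D.Adj v u}.ncard

/-- Every vertex can be reached from every vertex along a directed walk. -/
def IsStronglyConnected (D : Digraph V) : Prop :=
  ∀ u v : V, Relation.ReflTransGen D.Adj u v

/-- `L` is the arc set of a Hamiltonian cycle of `D`: for some enumeration
`v 0, …, v (n - 1)` of all the vertices, each exactly once, `L` consists of the arcs
`v 0 → v 1 → ⋯ → v (n - 1) → v 0`, all of which are arcs of `D`. -/
def IsHamiltonianCycle [Fintype V] (D : Digraph V) (L : Set (V × V)) : Prop :=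
  ∃ v : Fin (Fintype.card V) ≃ V,
    (∀ i, D.Adj (v i) (v (finRotate _ i))) ∧
      L = Set.range fun i => (v i, v (finRotate _ i))

end Digraph

/-! Ghouila-Houri's theorem (`exists_hamiltonian`) gives one Hamiltonian cycle; delete its arcs. If
`n = 2m`, the remaining semidegrees are still at least `m`, and the same theorem gives the second
cycle. If `n = 2m + 1`, they are at least `m`, just short of the bound, and the remaining digraph
may be non-Hamiltonian (`Crit`). Its structure is then played off against the deleted cycle.

In a critical digraph, take a longest cycle and an unextendable path off it. The degree count behind
Ghouila-Houri becomes an equality, which leaves two outcomes (`Crit.mis_or_cutVertex`): a cycle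
missing a single vertex `u`, or two sets of `m` vertices with no arcs between them, separated by one
vertex. In the second outcome every vertex of either set needs a deleted arc into the other set, so
the deleted cycle never reaches the separating vertex (`not_cutVertex`).

With a cycle missing only `u`, each vertex of the cycle sends an arc to `u` exactly when `u` sends
none to its successor (`Mis.counts`). If non-in-neighbours are never consecutive, for any such `u`
and cycle, they alternate with in-neighbours, and an independent set of `m + 1` vertices appears;
the deleted cycle would be trapped in it (`not_independent`). Otherwise there is a `LongGap`.
Rerouting arguments, repeated after exchanging the missing vertex, exclude this for `m ≥ 4`
(`LongGap.lt_four`) and force explicit subdigraphs for `m = 2` and `m = 3`. On five vertices no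
Hamiltonian cycle is disjoint from the forced arcs. On seven vertices one may be, but its arcs
together with the forced ones always contain a new pair of arc-disjoint Hamiltonian cycles
(`seven_check`). -/

namespace ArcDisjoint

/-! ### Walks as lists, and cycles as periodic sequences. -/

variable {V : Type*} {r : V → V → Prop}

/-- `l` lists the vertices of a directed walk from `a` to `b`. -/
def IsWalk (r : V → V → Prop) (a : V) (l : List V) (b : V) : Prop :=
  l.IsChain r ∧ l.head? = some a ∧ l.getLast? = some b

theorem IsWalk.single (a : V) : IsWalk r a [a] a := by simp [IsWalk]

theorem IsWalk.append {a b c d : V} {l l' : List V} (h : IsWalk r a l b) (hbc : r b c)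
    (h' : IsWalk r c l' d) : IsWalk r a (l ++ l') d := by
  obtain ⟨h1, h2, h3⟩ := h
  obtain ⟨k1, k2, k3⟩ := h'
  refine ⟨List.isChain_append.2 ⟨h1, k1, ?_⟩, ?_, ?_⟩
  · intro x hx y hy
    rw [h3, Option.mem_some_iff] at hx
    rw [k2, Option.mem_some_iff] at hy
    subst hx hy
    exact hbc
  · rw [List.head?_append, h2]; rfl
  · rw [List.getLast?_append, k3]; rfl

theorem IsWalk.cons {a c d : V} {l' : List V} (hbc : r a c)
    (h' : IsWalk r c l' d) : IsWalk r a (a :: l') d :=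
  (IsWalk.single a).append hbc h'

/-- `l` lists the vertices of a directed cycle, each exactly once. -/
def IsCycleList (r : V → V → Prop) (l : List V) : Prop :=
  l.Nodup ∧ ∃ a b, IsWalk r a l b ∧ r b a

/-- The list `c i, c (i + 1), …, c (i + n - 1)`. -/
def seg (c : ℕ → V) (i n : ℕ) : List V := (List.range n).map fun j => c (i + j)

theorem seg_length (c : ℕ → V) (i n : ℕ) : (seg c i n).length = n := by simp [seg]

theorem seg_add (c : ℕ → V) (i n p : ℕ) : seg c i (n + p) = seg c i n ++ seg c (i + n) p := by
  simp [seg, List.range_add, Function.comp_def, Nat.add_assoc]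

theorem seg_one (c : ℕ → V) (i : ℕ) : seg c i 1 = [c i] := by simp [seg]

theorem seg_succ' (c : ℕ → V) (i n : ℕ) : seg c i (n + 1) = seg c i n ++ [c (i + n)] := by
  rw [seg_add, seg_one]

theorem mem_seg {c : ℕ → V} {i n : ℕ} {v : V} : v ∈ seg c i n ↔ ∃ j < n, c (i + j) = v := by
  simp [seg]

theorem isWalk_seg {c : ℕ → V} {i n : ℕ} (h : ∀ j, i ≤ j → j < i + n → r (c j) (c (j + 1))) :
    IsWalk r (c i) (seg c i (n + 1)) (c (i + n)) := by
  induction n with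
  | zero => rw [seg_one]; exact IsWalk.single _
  | succ n ih =>
    rw [seg_succ']
    exact (ih fun j h1 h2 => h j h1 (by omega)).append (h (i + n) (by omega) (by omega))
      (IsWalk.single _)

/-- `c` runs through a directed cycle of length `n` periodically. -/
structure Cyc (r : V → V → Prop) (n : ℕ) (c : ℕ → V) : Prop where
  pos : 0 < n
  per : ∀ i, c (i + n) = c i
  inj : ∀ i < n, ∀ j < n, c i = c j → i = j
  adj : ∀ i, r (c i) (c (i + 1))

namespace Cyc

variable {n : ℕ} {c : ℕ → V}

theorem per_mul (h : Cyc r n c) (i k : ℕ) : c (i + n * k) = c i := by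
  induction k with
  | zero => simp
  | succ k ih => rw [Nat.mul_succ, ← Nat.add_assoc, h.per, ih]

theorem mod (h : Cyc r n c) (i : ℕ) : c (i % n) = c i := by
  conv_rhs => rw [← Nat.mod_add_div i n]
  rw [h.per_mul]

theorem eq_iff (h : Cyc r n c) (i j : ℕ) : c i = c j ↔ i % n = j % n := by
  constructor
  · intro hij
    rw [← h.mod i, ← h.mod j] at hij
    exact h.inj _ (Nat.mod_lt _ h.pos) _ (Nat.mod_lt _ h.pos) hij
  · intro hij
    rw [← h.mod i, ← h.mod j, hij]

theorem exists_add_eq (h : Cyc r n c) (s i : ℕ) : ∃ j < n, c (s + j) = c i := by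
  have hle : s ≤ n * s := Nat.le_mul_of_pos_left s h.pos
  refine ⟨(i + n * s - s) % n, Nat.mod_lt _ h.pos, ?_⟩
  rw [h.eq_iff, Nat.add_mod_mod, show s + (i + n * s - s) = i + n * s by omega]
  simp

theorem ne_of_lt (h : Cyc r n c) {i j : ℕ} (hij : i < j) (hj : j < i + n) : c i ≠ c j := by
  rw [Ne, h.eq_iff]
  intro he
  have h1 : (j - i) % n = 0 := by
    have := (Nat.modEq_iff_dvd' hij.le).1 he
    exact Nat.mod_eq_zero_of_dvd this
  rw [Nat.mod_eq_of_lt (by omega)] at h1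
  omega

theorem shift (h : Cyc r n c) (k : ℕ) : Cyc r n fun i => c (k + i) where
  pos := h.pos
  per i := by rw [← Nat.add_assoc]; exact h.per _
  inj i hi j hj hij := by
    rcases Nat.lt_trichotomy i j with hl | hl | hl
    · exact absurd hij (h.ne_of_lt (by omega) (by omega))
    · exact hl
    · exact absurd hij.symm (h.ne_of_lt (by omega) (by omega))
  adj i := h.adj _

theorem seg_nodup (h : Cyc r n c) (i : ℕ) {p : ℕ} (hp : p ≤ n) : (seg c i p).Nodup := by
  refine List.Nodup.map_on ?_ List.nodup_range
  intro x hx y hy hxy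
  rw [List.mem_range] at hx hy
  exact (h.shift i).inj x (by omega) y (by omega) hxy

theorem isWalk (h : Cyc r n c) (i k : ℕ) : IsWalk r (c i) (seg c i (k + 1)) (c (i + k)) :=
  isWalk_seg fun j _ _ => h.adj j

/-- Walk along the cycle from index `i` to index `j`. -/
theorem isWalk' (h : Cyc r n c) {i j k : ℕ} (hk : i + k = j + 1) (hij : i ≤ j) :
    IsWalk r (c i) (seg c i k) (c j) := by
  obtain ⟨d, rfl⟩ := Nat.exists_eq_add_of_le hij
  obtain rfl : k = d + 1 := by omega
  exact h.isWalk i d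

theorem of_list {l : List V} {a b : V} (hl : l.Nodup) (hw : IsWalk r a l b) (hba : r b a) :
    ∃ c, Cyc r l.length c ∧ seg c 0 l.length = l ∧ c 0 = a ∧ c (l.length - 1) = b := by
  obtain ⟨h1, h2, h3⟩ := hw
  have hne : l ≠ [] := by rintro rfl; simp at h2
  have hpos : 0 < l.length := List.length_pos_iff.2 hne
  have hget : ∀ i, i % l.length < l.length := fun i => Nat.mod_lt _ hpos
  have ha : l[0] = a := by
    rw [List.head?_eq_getElem?, List.getElem?_eq_getElem hpos] at h2
    exact Option.some.inj h2
  have hb : l[l.length - 1]'(by omega) = b := by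
    rw [List.getLast?_eq_getElem?, List.getElem?_eq_getElem (by omega)] at h3
    exact Option.some.inj h3
  refine ⟨fun i => l[i % l.length]'(hget i), ⟨hpos, ?_, ?_, ?_⟩, ?_, ?_, ?_⟩
  · intro i
    simp
  · intro i hi j hj hij
    have := (hl.getElem_inj_iff).1 hij
    rwa [Nat.mod_eq_of_lt hi, Nat.mod_eq_of_lt hj] at this
  · intro i
    have hm := hget i
    rcases Nat.lt_or_ge (i % l.length + 1) l.length with h | h
    · have e : (i + 1) % l.length = i % l.length + 1 := by
        rw [Nat.add_mod, Nat.mod_eq_of_lt (show 1 < l.length by omega), Nat.mod_eq_of_lt h]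
      have := h1.getElem (i % l.length) h
      simpa only [e] using this
    · have e1 : i % l.length = l.length - 1 := by omega
      have e2 : (i + 1) % l.length = 0 := by
        conv_lhs => rw [← Nat.mod_add_div i l.length]
        rw [show i % l.length + l.length * (i / l.length) + 1
          = l.length + l.length * (i / l.length) by omega]
        simp
      simp only [e1, e2, ha, hb]
      exact hba
  · apply List.ext_getElem
    · simp [seg]
    · intro i h1 h2
      simp [seg, Nat.mod_eq_of_lt h2]
  · simpa using ha
  · simp only [Nat.mod_eq_of_lt (show l.length - 1 < l.length by omega)]
    exact hb

end Cyc

/-! ### Cycles missing one vertex of a critical digraph. -/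

/-- `c` is a cycle through all vertices but `u`. -/
structure Mis (r : V → V → Prop) (m : ℕ) (u : V) (c : ℕ → V) : Prop where
  cyc : Cyc r (2 * m) c
  ne : ∀ i, c i ≠ u

namespace Mis

variable {m : ℕ} {u : V} {c : ℕ → V}

theorem shift (h : Mis r m u c) (k : ℕ) : Mis r m u fun i => c (k + i) :=
  ⟨h.cyc.shift k, fun _ => h.ne _⟩

theorem pos (h : Mis r m u c) : 0 < m := by have := h.cyc.pos; omega

theorem base_nodup (h : Mis r m u c) (k : ℕ) : (u :: seg c k (2 * m)).Nodup := by
  rw [List.nodup_cons]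
  refine ⟨?_, h.cyc.seg_nodup k le_rfl⟩
  rw [mem_seg]
  rintro ⟨j, -, hj⟩
  exact h.ne _ hj

end Mis

section Degrees

variable [Fintype V]

open Classical in
/-- The set of out-neighbours. -/
noncomputable def outN (r : V → V → Prop) (v : V) : Finset V := Finset.univ.filter fun x => r v x

open Classical in
/-- The set of in-neighbours. -/
noncomputable def inN (r : V → V → Prop) (v : V) : Finset V := Finset.univ.filter fun x => r x v

@[simp] theorem mem_outN {v x : V} : x ∈ outN r v ↔ r v x := by simp [outN]

@[simp] theorem mem_inN {v x : V} : x ∈ inN r v ↔ r x v := by simp [inN]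

/-- Loopless digraphs on `2 * m + 1` vertices with all semidegrees at least `m` and without a
Hamiltonian cycle. -/
structure Crit (r : V → V → Prop) (m : ℕ) : Prop where
  card : Fintype.card V = 2 * m + 1
  irr : ∀ v, ¬ r v v
  out : ∀ v, m ≤ (outN r v).card
  inn : ∀ v, m ≤ (inN r v).card
  nonham : ∀ l, IsCycleList r l → l.length ≠ 2 * m + 1

namespace Mis

variable {m : ℕ} {u : V} {c : ℕ → V}

theorem exists_eq (h : Mis r m u c) (hc : Crit r m) (k : ℕ) {v : V} (hv : v ≠ u) :
    ∃ i < 2 * m, c (k + i) = v := by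
  classical
  have hn := h.base_nodup k
  have h1 : (u :: seg c k (2 * m)).toFinset = Finset.univ := by
    apply Finset.eq_univ_of_card
    rw [List.toFinset_card_of_nodup hn, hc.card]
    simp [seg_length]
  have h2 : v ∈ (u :: seg c k (2 * m)).toFinset := by rw [h1]; exact Finset.mem_univ _
  rw [List.mem_toFinset, List.mem_cons, mem_seg] at h2
  exact h2.resolve_left hv

-- The arcs `c i → u` and `u → c (i + 1)` cannot both exist, or `u` could be inserted between the
-- two vertices. At least `m` arcs of each kind share only `2 * m` positions, so exactly one of the
-- two occurs at each position.
open Classical in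
theorem counts (h : Mis r m u c) (hc : Crit r m) :
    (∀ i, r (c i) u ↔ ¬ r u (c (i + 1))) ∧ (outN r u).card = m ∧ (inN r u).card = m ∧
      ((Finset.range (2 * m)).filter fun i => ¬ r (c i) u).card = m := by
  set S := (Finset.range (2 * m)).filter fun i => r (c i) u with hS
  set T := (Finset.range (2 * m)).filter fun i => r u (c (i + 1)) with hT
  have injS : Set.InjOn c S := by
    intro i hi j hj hij
    simp only [hS, Finset.coe_filter, Finset.mem_range, Set.mem_ofPred_eq] at hi hj
    exact h.cyc.inj i hi.1 j hj.1 hij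
  have injT : Set.InjOn (fun i => c (1 + i)) T := by
    intro i hi j hj hij
    simp only [hT, Finset.coe_filter, Finset.mem_range, Set.mem_ofPred_eq] at hi hj
    exact (h.cyc.shift 1).inj i hi.1 j hj.1 hij
  have eS : inN r u = S.image c := by
    ext v
    simp only [mem_inN, hS, Finset.mem_image, Finset.mem_filter, Finset.mem_range]
    constructor
    · intro hv
      have hvu : v ≠ u := by rintro rfl; exact hc.irr _ hv
      obtain ⟨i, hi, rfl⟩ := h.exists_eq hc 0 hvu
      rw [Nat.zero_add] at hv ⊢
      exact ⟨i, ⟨hi, hv⟩, rfl⟩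
    · rintro ⟨i, ⟨-, hi⟩, rfl⟩
      exact hi
  have eT : outN r u = T.image fun i => c (1 + i) := by
    ext v
    simp only [mem_outN, hT, Finset.mem_image, Finset.mem_filter, Finset.mem_range]
    constructor
    · intro hv
      have hvu : v ≠ u := by rintro rfl; exact hc.irr _ hv
      obtain ⟨i, hi, rfl⟩ := h.exists_eq hc 1 hvu
      exact ⟨i, ⟨hi, by rwa [Nat.add_comm i 1]⟩, rfl⟩
    · rintro ⟨i, ⟨-, hi⟩, rfl⟩
      rwa [Nat.add_comm 1 i]
  have cS : (inN r u).card = S.card := by rw [eS, Finset.card_image_of_injOn injS]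
  have cT : (outN r u).card = T.card := by rw [eT, Finset.card_image_of_injOn injT]
  have hno : ∀ i, r (c i) u → ¬ r u (c (i + 1)) := by
    intro i h1 h2
    have hp := h.cyc.pos
    refine hc.nonham (u :: seg c (i + 1) (2 * m)) ⟨h.base_nodup _, u, c (i + 2 * m), ?_, ?_⟩ ?_
    · exact IsWalk.cons h2 (h.cyc.isWalk' (by omega) (by omega))
    · rwa [h.cyc.per]
    · simp [seg_length]
  have hdis : Disjoint S T := by
    rw [Finset.disjoint_left]
    intro i hi hi'
    simp only [hS, hT, Finset.mem_filter] at hi hi'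
    exact hno i hi.2 hi'.2
  have hsub : S ∪ T ⊆ Finset.range (2 * m) :=
    Finset.union_subset (Finset.filter_subset _ _) (Finset.filter_subset _ _)
  have hcard := Finset.card_le_card hsub
  rw [Finset.card_union_of_disjoint hdis, Finset.card_range] at hcard
  have o := hc.out u
  have i := hc.inn u
  have huni : S ∪ T = Finset.range (2 * m) := by
    apply Finset.eq_of_subset_of_card_le hsub
    rw [Finset.card_union_of_disjoint hdis, Finset.card_range]
    omega
  refine ⟨fun j => ⟨hno j, fun hj => ?_⟩, by omega, by omega, ?_⟩
  · have : j % (2 * m) ∈ S ∪ T := by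
      rw [huni, Finset.mem_range]; exact Nat.mod_lt _ h.cyc.pos
    rw [Finset.mem_union] at this
    rcases this with h1 | h1
    · simp only [hS, Finset.mem_filter, h.cyc.mod] at h1
      exact h1.2
    · simp only [hT, Finset.mem_filter] at h1
      refine absurd ?_ hj
      have e : c (j % (2 * m) + 1) = c (j + 1) := by
        rw [h.cyc.eq_iff]; simp
      rw [← e]; exact h1.2
  · have := Finset.card_filter_add_card_filter_not (s := Finset.range (2 * m))
      (p := fun i => r (c i) u)
    rw [Finset.card_range] at this
    have hSm : S.card = m := by omega
    rw [← hS, hSm] at this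
    omega

theorem arc_iff (h : Mis r m u c) (hc : Crit r m) (i : ℕ) : r (c i) u ↔ ¬ r u (c (i + 1)) :=
  (h.counts hc).1 i

end Mis

/-- The dichotomy of `Mis.counts` at the closing arc of a listed cycle. Listing a rerouted cycle so
that it closes at a chosen arc turns known non-arcs into arcs. -/
theorem Crit.arc_iff {m : ℕ} (hc : Crit r m) {x a b : V} {l : List V} (hn : (x :: l).Nodup)
    (hl : l.length = 2 * m) (hw : IsWalk r a l b) (hba : r b a) : r b x ↔ ¬ r x a := by
  rw [List.nodup_cons] at hn
  obtain ⟨c, h1, h2, h3, h4⟩ := Cyc.of_list hn.2 hw hba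
  rw [hl] at h1 h2 h4
  have hm : Mis r m x c := by
    refine ⟨h1, fun i hi => hn.1 ?_⟩
    rw [← h2, mem_seg]
    exact ⟨i % (2 * m), Nat.mod_lt _ h1.pos, by rw [Nat.zero_add, h1.mod, hi]⟩
  have := hm.arc_iff hc (2 * m - 1)
  have hp := h1.pos
  rw [h4, show 2 * m - 1 + 1 = 0 + 2 * m by omega, h1.per, h3] at this
  exact this

end Degrees

end ArcDisjoint

/-! ### Long gaps: which arcs they force and forbid. -/

namespace ArcDisjoint

variable {V : Type*} {r : V → V → Prop}

theorem seg_split (c : ℕ → V) {k n a k' b : ℕ} (hn : n = a + b) (hk : k' = k + a) :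
    seg c k n = seg c k a ++ seg c k' b := by
  subst hn hk; exact seg_add c k a b

theorem seg_getElem (c : ℕ → V) (k n i : ℕ) (hi : i < (seg c k n).length) :
    (seg c k n)[i] = c (k + i) := by simp [seg]

/-- Here `u` takes the place of `c k`, and the indexing restarts at `u`. -/
theorem Cyc.of_cons_seg {n : ℕ} {c : ℕ → V} {u : V} {k : ℕ} (hc : Cyc r n c) (hn : 1 < n)
    (hu : ∀ i, c i ≠ u) (h1 : r u (c (k + 1))) (h2 : r (c (k + n - 1)) u) :
    ∃ d, Cyc r n d ∧ d 0 = u ∧ ∀ i, 0 < i → i < n → d i = c (k + i) := by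
  have hw : IsWalk r u (u :: seg c (k + 1) (n - 1)) (c (k + n - 1)) :=
    IsWalk.cons h1 (hc.isWalk' (by omega) (by omega))
  have hnd : (u :: seg c (k + 1) (n - 1)).Nodup := by
    rw [List.nodup_cons]
    refine ⟨?_, hc.seg_nodup _ (by omega)⟩
    rw [mem_seg]
    rintro ⟨j, -, hj⟩
    exact hu _ hj
  have hlen : (u :: seg c (k + 1) (n - 1)).length = n := by
    rw [List.length_cons, seg_length]; omega
  obtain ⟨d, e1, e2, e3, -⟩ := Cyc.of_list hnd hw h2
  rw [hlen] at e1 e2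
  refine ⟨d, e1, e3, fun i h0 hi => ?_⟩
  have h3 : (seg d 0 n)[i]'(by rw [seg_length]; exact hi)
      = (u :: seg c (k + 1) (n - 1))[i]'(by rw [hlen]; exact hi) := by simp only [e2]
  obtain ⟨i, rfl⟩ : ∃ p, i = p + 1 := ⟨i - 1, by omega⟩
  rw [seg_getElem, List.getElem_cons_succ, seg_getElem] at h3
  rw [show 0 + (i + 1) = i + 1 by omega] at h3
  rw [h3]; congr 1; omega

/-- A cycle `c` missing only `u` and meeting the non-in-neighbour `c 0` of `u` just after an
in-neighbour of `u`, such that `c 1` is not an in-neighbour of `c 0` either. -/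
structure LongGap (r : V → V → Prop) (m : ℕ) (u : V) (c : ℕ → V) : Prop where
  mis : Mis r m u c
  zero : ¬ r (c 0) u
  last : r (c (2 * m - 1)) u
  long : ¬ r (c 1) (c 0)

theorem LongGap.two_le {m : ℕ} {u : V} {c : ℕ → V} (h : LongGap r m u c) : 2 ≤ m := by
  have hp := h.mis.pos
  by_contra hm
  obtain rfl : m = 1 := by omega
  apply h.long
  have h1 := h.mis.cyc.adj 1
  have h2 := h.mis.cyc.per 0
  rwa [show 1 + 1 = 0 + 2 * 1 by omega, h2] at h1

namespace LongGap

variable {m : ℕ} {u : V} {c : ℕ → V}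

theorem last_zero (h : LongGap r m u c) : r (c (2 * m - 1)) (c 0) := by
  have hp := h.mis.pos
  have := h.mis.cyc.adj (2 * m - 1)
  rwa [show 2 * m - 1 + 1 = 0 + 2 * m by omega, h.mis.cyc.per] at this

/-- The situation at a later gap, starting at `c g`, of the in-neighbours of `u`. -/
structure GapAt (r : V → V → Prop) (m : ℕ) (u : V) (c : ℕ → V) (g : ℕ) : Prop where
  three_le : 3 ≤ g
  lt : g < 2 * m
  pred : r (c (g - 1)) u
  not : ¬ r (c g) u

theorem GapAt.lt' {g : ℕ} (hg : GapAt r m u c g) (h : LongGap r m u c) : g + 1 < 2 * m := by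
  rcases Nat.lt_or_ge (g + 1) (2 * m) with h4 | h4
  · exact h4
  · have := hg.lt
    exact absurd h.last (by rw [show 2 * m - 1 = g by omega]; exact hg.not)

theorem gap_perm {g : ℕ} (hg : GapAt r m u c g) (h : LongGap r m u c) :
    (u :: seg c 0 (2 * m)).Perm ([u] ++ ([c 0] ++ ([c 1] ++ (seg c 2 (g - 2) ++ ([c g] ++
      seg c (g + 1) (2 * m - 1 - g)))))) := by
  have h3 := hg.three_le
  have h4 := hg.lt' h
  rw [seg_split c (k := 0) (a := 1) (k' := 1) (b := 2 * m - 1) (by omega) (by omega),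
      seg_split c (k := 1) (a := 1) (k' := 2) (b := 2 * m - 2) (by omega) (by omega),
      seg_split c (k := 2) (n := 2 * m - 2) (a := g - 2) (k' := g) (b := 2 * m - g)
        (by omega) (by omega),
      seg_split c (k := g) (a := 1) (k' := g + 1) (b := 2 * m - 1 - g) (by omega) (by omega),
      seg_one, seg_one, seg_one]
  exact List.Perm.refl _

end LongGap

variable [Fintype V] {m : ℕ} {u : V} {c : ℕ → V}

/-- Since `c (g + 1)` is not an in-neighbour of `u`, the dichotomy gives `u → c (g + 2)`, so `u`
fits into the place of `c (g + 1)`, which becomes the missing vertex. -/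
theorem Mis.swap (h : Mis r m u c) (hc : Crit r m) {g : ℕ} (h1 : r (c g) u)
    (h2 : ¬ r (c (g + 1)) u) :
    ∃ d, Mis r m (c (g + 1)) d ∧ d 0 = u ∧ ∀ i, 0 < i → i < 2 * m → d i = c (g + 1 + i) := by
  have hp := h.pos
  have h3 : r u (c (g + 1 + 1)) := by
    by_contra h3; exact h2 ((h.arc_iff hc (g + 1)).2 h3)
  obtain ⟨d, e1, e2, e3⟩ := h.cyc.of_cons_seg (k := g + 1) (by omega) h.ne h3
    (by rw [show g + 1 + 2 * m - 1 = g + 2 * m by omega, h.cyc.per]; exact h1)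
  refine ⟨d, ⟨e1, fun i => ?_⟩, e2, e3⟩
  rw [← e1.mod i]
  have hlt := Nat.mod_lt i h.cyc.pos
  rcases Nat.eq_zero_or_pos (i % (2 * m)) with h0 | h0
  · rw [h0, e2]; exact (h.ne _).symm
  · rw [e3 _ h0 hlt]
    exact (h.cyc.ne_of_lt (by omega) (by omega)).symm

/-- The source of all long gaps: after the swap, the second of two consecutive non-in-neighbours
follows `u` on the cycle and sends no arc back to it. -/
theorem Mis.longGap (h : Mis r m u c) (hc : Crit r m) {g : ℕ} (h1 : r (c g) u)
    (h2 : ¬ r (c (g + 1)) u) (h3 : ¬ r (c (g + 2)) u) :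
    ∃ d, LongGap r m (c (g + 1)) d ∧ d 0 = u ∧
      ∀ i, 0 < i → i < 2 * m → d i = c (g + 1 + i) := by
  have hp := h.pos
  obtain ⟨d, e1, e2, e3⟩ := h.swap hc h1 h2
  refine ⟨d, ⟨e1, ?_, ?_, ?_⟩, e2, e3⟩
  · rw [e2]; exact (h.arc_iff hc g).1 h1
  · rw [e3 _ (by omega) (by omega), show g + 1 + (2 * m - 1) = g + 2 * m by omega, h.cyc.per]
    exact h.cyc.adj g
  · rw [e2, e3 1 (by omega) (by omega)]; exact h3

theorem Mis.not_cycle_of_perm (h : Mis r m u c) (hc : Crit r m) {l : List V} {a b : V}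
    (hp : l.Perm (u :: seg c 0 (2 * m))) (hw : IsWalk r a l b) (hba : r b a) : False := by
  refine hc.nonham l ⟨hp.nodup_iff.2 (h.base_nodup 0), a, b, hw, hba⟩ ?_
  rw [hp.length_eq]; simp [seg_length]

theorem Mis.arc_iff_of_perm (h : Mis r m u c) (hc : Crit r m) {l : List V} {x a b : V}
    (hp : (x :: l).Perm (u :: seg c 0 (2 * m))) (hw : IsWalk r a l b) (hba : r b a) :
    r b x ↔ ¬ r x a := by
  refine hc.arc_iff (hp.nodup_iff.2 (h.base_nodup 0)) ?_ hw hba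
  have := hp.length_eq
  simpa [seg_length] using this

namespace LongGap

theorem u_adj_one (h : LongGap r m u c) (hc : Crit r m) : r u (c 1) := by
  by_contra h1
  exact h.zero ((h.mis.arc_iff hc 0).2 h1)

theorem mis_zero (h : LongGap r m u c) (hc : Crit r m) :
    ∃ d, Mis r m (c 0) d ∧ d 0 = u ∧ ∀ i, 0 < i → i < 2 * m → d i = c i := by
  have hp := h.mis.pos
  have e : c (2 * m - 1 + 1) = c 0 := by
    rw [show 2 * m - 1 + 1 = 0 + 2 * m by omega, h.mis.cyc.per]
  obtain ⟨d, e1, e2, e3⟩ := h.mis.swap hc h.last (by rw [e]; exact h.zero)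
  rw [e] at e1
  refine ⟨d, e1, e2, fun i h0 hi => ?_⟩
  rw [e3 i h0 hi, show 2 * m - 1 + 1 + i = i + 2 * m by omega, h.mis.cyc.per]

theorem arc_iff_zero (h : LongGap r m u c) (hc : Crit r m) {j : ℕ} (h1 : 1 ≤ j)
    (h2 : j + 1 < 2 * m) : r (c j) (c 0) ↔ ¬ r (c 0) (c (j + 1)) := by
  obtain ⟨d, e1, e2, e3⟩ := h.mis_zero hc
  have := e1.arc_iff hc j
  rwa [e3 j h1 (by omega), e3 (j + 1) (by omega) h2] at this

theorem not_u_zero (h : LongGap r m u c) (hc : Crit r m) : ¬ r u (c 0) := by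
  have hp := h.mis.pos
  have := (h.mis.arc_iff hc (2 * m - 1)).1 h.last
  rwa [show 2 * m - 1 + 1 = 0 + 2 * m by omega, h.mis.cyc.per] at this

theorem zero_two (h : LongGap r m u c) (hc : Crit r m) : r (c 0) (c 2) := by
  have := h.two_le
  by_contra h1
  exact h.long ((h.arc_iff_zero hc le_rfl (by omega)).2 h1)

theorem outN_zero_card (h : LongGap r m u c) (hc : Crit r m) : (outN r (c 0)).card = m := by
  obtain ⟨d, e1, -, -⟩ := h.mis_zero hc
  exact (e1.counts hc).2.1

theorem outN_card (h : LongGap r m u c) (hc : Crit r m) : (outN r u).card = m :=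
  (h.mis.counts hc).2.1

/-- If the cycle jumped from `c j` to `c i`, the skipped segment could be put back between `u` and
`c 0`, giving a Hamiltonian cycle. -/
theorem forward_of_u (h : LongGap r m u c) (hc : Crit r m) {i j : ℕ} (hj : 1 ≤ j) (hij : j + 2 ≤ i)
    (hi : i < 2 * m) (h1 : r u (c (j + 1))) (h2 : r (c (i - 1)) (c 0)) : ¬ r (c j) (c i) := by
  classical
  intro h3
  have C := h.mis.cyc
  refine h.mis.not_cycle_of_perm hc (l := seg c 1 j ++ (seg c i (2 * m - i) ++ ([u] ++
    (seg c (j + 1) (i - 1 - j) ++ [c 0])))) (a := c 1) (b := c 0) ?_ ?_ (C.adj 0)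
  · rw [seg_split c (k := 0) (a := 1) (k' := 1) (b := 2 * m - 1) (by omega) (by omega),
      seg_split c (k := 1) (n := 2 * m - 1) (a := j) (k' := j + 1) (b := 2 * m - 1 - j)
        (by omega) (by omega),
      seg_split c (k := j + 1) (n := 2 * m - 1 - j) (a := i - 1 - j) (k' := i) (b := 2 * m - i)
        (by omega) (by omega),
      seg_one, List.perm_iff_count]
    intro a
    simp only [List.count_append, List.count_cons, List.count_nil]
    ring
  · exact (C.isWalk' (by omega) hj).append h3 <|
      (C.isWalk' (j := 2 * m - 1) (by omega) (by omega)).append h.last <|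
      (IsWalk.single u).append h1 <| (C.isWalk' (j := i - 1) (by omega) (by omega)).append h2 <|
      IsWalk.single _

/-- The same rerouting with `u` and `c 0` interchanged: each of them closes the path `c 1, …, c (2 *
m - 1)` to a cycle. -/
theorem forward_of_zero (h : LongGap r m u c) (hc : Crit r m) {i j : ℕ} (hj : 1 ≤ j)
    (hij : j + 2 ≤ i) (hi : i < 2 * m) (h1 : r (c 0) (c (j + 1))) (h2 : r (c (i - 1)) u) :
    ¬ r (c j) (c i) := by
  classical
  intro h3
  have C := h.mis.cyc
  refine h.mis.not_cycle_of_perm hc (l := seg c 1 j ++ (seg c i (2 * m - i) ++ ([c 0] ++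
    (seg c (j + 1) (i - 1 - j) ++ [u])))) (a := c 1) (b := u) ?_ ?_ (h.u_adj_one hc)
  · rw [seg_split c (k := 0) (a := 1) (k' := 1) (b := 2 * m - 1) (by omega) (by omega),
      seg_split c (k := 1) (n := 2 * m - 1) (a := j) (k' := j + 1) (b := 2 * m - 1 - j)
        (by omega) (by omega),
      seg_split c (k := j + 1) (n := 2 * m - 1 - j) (a := i - 1 - j) (k' := i) (b := 2 * m - i)
        (by omega) (by omega),
      seg_one, List.perm_iff_count]
    intro a
    simp only [List.count_append, List.count_cons, List.count_nil]
    ring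
  · exact (C.isWalk' (by omega) hj).append h3 <|
      (C.isWalk' (j := 2 * m - 1) (by omega) (by omega)).append h.last_zero <|
      (IsWalk.single _).append h1 <| (C.isWalk' (j := i - 1) (by omega) (by omega)).append h2 <|
      IsWalk.single _

/-- Every vertex other than `u` is some `c i`. -/
theorem cases_vertex (h : LongGap r m u c) (hc : Crit r m) (v : V) :
    v = u ∨ ∃ i < 2 * m, c i = v := by
  by_cases hv : v = u
  · exact Or.inl hv
  · obtain ⟨i, hi, e⟩ := h.mis.exists_eq hc 0 hv
    exact Or.inr ⟨i, hi, by simpa using e⟩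

/-- Otherwise `u → c 2`, and `forward_of_u` confines the out-neighbours of `c 1` to `c 2` and those
of `c 0` other than `c 1`, `c 2`. As `c 0` has only `m` out-neighbours, two of them `c 1` and `c 2`,
at most `m - 1` vertices remain. -/
theorem one_u (h : LongGap r m u c) (hc : Crit r m) : r (c 1) u := by
  classical
  by_contra h1
  have hm := h.two_le
  have C := h.mis.cyc
  have h2 : r u (c 2) := by
    by_contra h2; exact h1 ((h.mis.arc_iff hc 1).2 h2)
  have hsub : outN r (c 1) ⊆ insert (c 2) (outN r (c 0) \ {c 1, c 2}) := by
    intro v hv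
    rw [mem_outN] at hv
    rcases h.cases_vertex hc v with rfl | ⟨i, hi, rfl⟩
    · exact absurd hv h1
    · rcases Nat.lt_or_ge i 3 with h3 | h3
      · interval_cases i
        · exact absurd hv h.long
        · exact absurd hv (hc.irr _)
        · exact Finset.mem_insert_self _ _
      · refine Finset.mem_insert_of_mem ?_
        rw [Finset.mem_sdiff, mem_outN, Finset.mem_insert, Finset.mem_singleton]
        refine ⟨?_, ?_⟩
        · by_contra h4
          refine h.forward_of_u hc le_rfl h3 hi h2 ?_ hv
          have := (h.arc_iff_zero hc (j := i - 1) (by omega) (by omega)).2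
          rw [show i - 1 + 1 = i by omega] at this
          exact this h4
        · rintro (h4 | h4)
          · exact C.ne_of_lt (by omega) (by omega) h4.symm
          · exact C.ne_of_lt (by omega) (by omega) h4.symm
  have h5 := Finset.card_le_card hsub
  have h6 := Finset.card_insert_le (c 2) (outN r (c 0) \ {c 1, c 2})
  have h7 : ({c 1, c 2} : Finset V) ⊆ outN r (c 0) := by
    intro v hv
    rw [Finset.mem_insert, Finset.mem_singleton] at hv
    rcases hv with rfl | rfl
    · rw [mem_outN]; exact C.adj 0
    · rw [mem_outN]; exact h.zero_two hc
  rw [Finset.card_sdiff_of_subset h7, h.outN_zero_card hc,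
    Finset.card_pair (C.ne_of_lt (by omega) (by omega))] at h6
  have := hc.out (c 1)
  omega

theorem u_iff (h : LongGap r m u c) (hc : Crit r m) {j : ℕ} (hj : 1 ≤ j) :
    r u (c j) ↔ ¬ r (c (j - 1)) u := by
  have := h.mis.arc_iff hc (j - 1)
  rw [show j - 1 + 1 = j by omega] at this
  tauto

/-- Such an arc would close the Hamiltonian cycle `c 2, …, c j, c 1, u, c (j + 1), …, c (2 * m - 1),
c 0`. -/
theorem not_adj_one (h : LongGap r m u c) (hc : Crit r m) {j : ℕ} (hj : 2 ≤ j) (hj' : j < 2 * m)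
    (h1 : ¬ r (c j) u) : ¬ r (c j) (c 1) := by
  classical
  intro h3
  have C := h.mis.cyc
  have hj2 : j + 1 < 2 * m := by
    rcases Nat.lt_or_ge (j + 1) (2 * m) with h4 | h4
    · exact h4
    · exact absurd h.last (by rwa [show 2 * m - 1 = j by omega])
  refine h.mis.not_cycle_of_perm hc (l := seg c 2 (j - 1) ++ ([c 1] ++ ([u] ++
    (seg c (j + 1) (2 * m - 1 - j) ++ [c 0])))) (a := c 2) (b := c 0) ?_ ?_ (h.zero_two hc)
  · rw [seg_split c (k := 0) (a := 1) (k' := 1) (b := 2 * m - 1) (by omega) (by omega),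
      seg_split c (k := 1) (a := 1) (k' := 2) (b := 2 * m - 2) (by omega) (by omega),
      seg_split c (k := 2) (n := 2 * m - 2) (a := j - 1) (k' := j + 1) (b := 2 * m - 1 - j)
        (by omega) (by omega),
      seg_one, seg_one, List.perm_iff_count]
    intro a
    simp only [List.count_append, List.count_cons, List.count_nil]
    ring
  · exact (C.isWalk' (by omega) hj).append h3 <| (IsWalk.single _).append (h.one_u hc) <|
      (IsWalk.single _).append ((h.u_iff hc (j := j + 1) (by omega)).2 h1) <|
      (C.isWalk' (j := 2 * m - 1) (by omega) (by omega)).append h.last_zero <| IsWalk.single _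

theorem not_one_adj (h : LongGap r m u c) (hc : Crit r m) {i : ℕ} (hi : 3 ≤ i) (hi' : i < 2 * m)
    (h1 : ¬ r u (c i)) : ¬ r (c 1) (c i) := by
  refine h.forward_of_zero hc le_rfl hi hi' (h.zero_two hc) ?_
  by_contra h2
  exact h1 ((h.u_iff hc (by omega)).2 h2)

variable {g : ℕ}

theorem gap_not_adj_one (h : LongGap r m u c) (hc : Crit r m) (hg : GapAt r m u c g) :
    ¬ r (c g) (c 1) :=
  h.not_adj_one hc (by have := hg.three_le; omega) hg.lt hg.not

theorem not_u_gap (h : LongGap r m u c) (hc : Crit r m) (hg : GapAt r m u c g) : ¬ r u (c g) := by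
  have := hg.three_le
  rw [h.u_iff hc (by omega), not_not]; exact hg.pred

theorem u_gap_succ (h : LongGap r m u c) (hc : Crit r m) (hg : GapAt r m u c g) :
    r u (c (g + 1)) :=
  (h.u_iff hc (by omega)).2 hg.not

theorem not_one_gap (h : LongGap r m u c) (hc : Crit r m) (hg : GapAt r m u c g) :
    ¬ r (c 1) (c g) :=
  h.not_one_adj hc hg.three_le hg.lt (h.not_u_gap hc hg)

/-- With `u` in the place of `c g`, the dichotomy for the missing `c g` is read at the arc `c 0 → c
1`; in `gap_two` it is read at `c 1 → c 2`. -/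
theorem zero_gap (h : LongGap r m u c) (hc : Crit r m) (hg : GapAt r m u c g) :
    r (c 0) (c g) := by
  classical
  have C := h.mis.cyc
  have h3 := hg.three_le
  have h4 := hg.lt' h
  have key := h.mis.arc_iff_of_perm hc (x := c g) (a := c 1) (b := c 0)
    (l := [c 1] ++ (seg c 2 (g - 2) ++ ([u] ++ (seg c (g + 1) (2 * m - 1 - g) ++ [c 0]))))
    (by
      refine List.Perm.trans ?_ (gap_perm hg h).symm
      rw [List.perm_iff_count]; intro a
      simp only [List.count_append, List.count_cons, List.count_nil]; ring)
    ((IsWalk.single _).append (C.adj 1) <|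
      (C.isWalk' (j := g - 1) (by omega) (by omega)).append hg.pred <|
      (IsWalk.single _).append (h.u_gap_succ hc hg) <|
      (C.isWalk' (j := 2 * m - 1) (by omega) (by omega)).append h.last_zero <| IsWalk.single _)
    (C.adj 0)
  exact key.2 (h.gap_not_adj_one hc hg)

theorem gap_two (h : LongGap r m u c) (hc : Crit r m) (hg : GapAt r m u c g) :
    r (c g) (c 2) := by
  classical
  have C := h.mis.cyc
  have h3 := hg.three_le
  have h4 := hg.lt' h
  have key := h.mis.arc_iff_of_perm hc (x := c g) (a := c 2) (b := c 1)
    (l := seg c 2 (g - 2) ++ ([u] ++ (seg c (g + 1) (2 * m - 1 - g) ++ ([c 0] ++ [c 1]))))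
    (by
      refine List.Perm.trans ?_ (gap_perm hg h).symm
      rw [List.perm_iff_count]; intro a
      simp only [List.count_append, List.count_cons, List.count_nil]; ring)
    ((C.isWalk' (j := g - 1) (by omega) (by omega)).append hg.pred <|
      (IsWalk.single _).append (h.u_gap_succ hc hg) <|
      (C.isWalk' (j := 2 * m - 1) (by omega) (by omega)).append h.last_zero <|
      (IsWalk.single _).append (C.adj 0) <| IsWalk.single _)
    (C.adj 1)
  by_contra h5
  exact h.not_one_gap hc hg (key.2 h5)

/-- The arc would allow a cycle missing only `c g` and containing `u → c 1`, whereas neither `u → c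
g` nor `c g → c 1` holds. -/
theorem not_one_gap_succ (h : LongGap r m u c) (hc : Crit r m) (hg : GapAt r m u c g) :
    ¬ r (c 1) (c (g + 1)) := by
  classical
  intro h5
  have C := h.mis.cyc
  have h3 := hg.three_le
  have h4 := hg.lt' h
  have key := h.mis.arc_iff_of_perm hc (x := c g) (a := c 1) (b := u)
    (l := [c 1] ++ (seg c (g + 1) (2 * m - 1 - g) ++ ([c 0] ++ (seg c 2 (g - 2) ++ [u]))))
    (by
      refine List.Perm.trans ?_ (gap_perm hg h).symm
      rw [List.perm_iff_count]; intro a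
      simp only [List.count_append, List.count_cons, List.count_nil]; ring)
    ((IsWalk.single _).append h5 <|
      (C.isWalk' (j := 2 * m - 1) (by omega) (by omega)).append h.last_zero <|
      (IsWalk.single _).append (h.zero_two hc) <|
      (C.isWalk' (j := g - 1) (by omega) (by omega)).append hg.pred <| IsWalk.single _)
    (h.u_adj_one hc)
  exact h.not_u_gap hc hg (key.2 (h.gap_not_adj_one hc hg))

/-- The arc would allow a cycle missing only `c g` and containing `c 1 → u`, whereas neither `c 1 →
c g` nor `c g → u` holds. -/
theorem not_gap_pred_one (h : LongGap r m u c) (hc : Crit r m) (hg : GapAt r m u c g) :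
    ¬ r (c (g - 1)) (c 1) := by
  classical
  intro h5
  have C := h.mis.cyc
  have h3 := hg.three_le
  have h4 := hg.lt' h
  have key := h.mis.arc_iff_of_perm hc (x := c g) (a := u) (b := c 1)
    (l := [u] ++ (seg c (g + 1) (2 * m - 1 - g) ++ ([c 0] ++ (seg c 2 (g - 2) ++ [c 1]))))
    (by
      refine List.Perm.trans ?_ (gap_perm hg h).symm
      rw [List.perm_iff_count]; intro a
      simp only [List.count_append, List.count_cons, List.count_nil]; ring)
    ((IsWalk.single _).append (h.u_gap_succ hc hg) <|
      (C.isWalk' (j := 2 * m - 1) (by omega) (by omega)).append h.last_zero <|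
      (IsWalk.single _).append (h.zero_two hc) <|
      (C.isWalk' (j := g - 1) (by omega) (by omega)).append h5 <| IsWalk.single _)
    (h.one_u hc)
  exact h.not_one_gap hc hg (key.2 hg.not)

theorem not_gap_pred_zero (h : LongGap r m u c) (hc : Crit r m) (hg : GapAt r m u c g) :
    ¬ r (c (g - 1)) (c 0) := by
  have h3 := hg.three_le
  have h4 := hg.lt
  have := h.arc_iff_zero hc (j := g - 1) (by omega) (by omega)
  rw [show g - 1 + 1 = g by omega] at this
  rw [this, not_not]
  exact h.zero_gap hc hg

theorem outN_one_subset (h : LongGap r m u c) (hc : Crit r m) {v : V} (hv : r (c 1) v) :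
    v = u ∨ v = c 2 ∨ (r u v ∧ v ≠ c 1) := by
  rcases h.cases_vertex hc v with rfl | ⟨i, hi, rfl⟩
  · exact Or.inl rfl
  · rcases Nat.lt_or_ge i 3 with h3 | h3
    · interval_cases i
      · exact absurd hv h.long
      · exact absurd hv (hc.irr _)
      · exact Or.inr (Or.inl rfl)
    · refine Or.inr (Or.inr ⟨?_, ?_⟩)
      · by_contra h4
        exact h.not_one_adj hc h3 hi h4 hv
      · exact (h.mis.cyc.ne_of_lt (by omega) (by omega)).symm

/-- Among the out-neighbours of `u` other than `c 1`, the vertex `c 1` misses at most one. -/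
theorem outN_one_almost (h : LongGap r m u c) (hc : Crit r m) {x y : V} (hx : r u x) (hy : r u y)
    (hx1 : x ≠ c 1) (hy1 : y ≠ c 1) (hxy : x ≠ y) (h1x : ¬ r (c 1) x) : r (c 1) y := by
  classical
  by_contra h1y
  have hsub : outN r (c 1) ⊆ insert u (insert (c 2) (outN r u \ {c 1, x, y})) := by
    intro v hv
    rw [mem_outN] at hv
    simp only [Finset.mem_insert, Finset.mem_sdiff, mem_outN, Finset.mem_singleton]
    rcases h.outN_one_subset hc hv with h2 | h2 | h2
    · exact Or.inl h2
    · exact Or.inr (Or.inl h2)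
    · refine Or.inr (Or.inr ⟨h2.1, ?_⟩)
      rintro (h3 | rfl | rfl)
      · exact h2.2 h3
      · exact h1x hv
      · exact h1y hv
  have h5 := Finset.card_le_card hsub
  have h6 := Finset.card_insert_le u (insert (c 2) (outN r u \ {c 1, x, y}))
  have h6' := Finset.card_insert_le (c 2) (outN r u \ {c 1, x, y})
  have h7 : ({c 1, x, y} : Finset V) ⊆ outN r u := by
    intro v hv
    simp only [Finset.mem_insert, Finset.mem_singleton] at hv
    rw [mem_outN]
    rcases hv with rfl | rfl | rfl
    · exact h.u_adj_one hc
    · exact hx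
    · exact hy
  have h8 : ({c 1, x, y} : Finset V).card = 3 :=
    Finset.card_eq_three.2 ⟨_, _, _, hx1.symm, hy1.symm, hxy, rfl⟩
  have h9 := Finset.card_le_card h7
  rw [Finset.card_sdiff_of_subset h7, h.outN_card hc, h8] at h6'
  rw [h.outN_card hc, h8] at h9
  have := hc.out (c 1)
  omega

/-- Each later gap provides an out-neighbour `c (g + 1)` of `u` that `c 1` misses, and `c 1` can
afford only one such miss. -/
theorem gap_unique (h : LongGap r m u c) (hc : Crit r m) {g' : ℕ} (hg : GapAt r m u c g)
    (hg' : GapAt r m u c g') : g = g' := by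
  by_contra hne
  have C := h.mis.cyc
  have h3 := hg.three_le
  have h4 := hg.lt' h
  have h3' := hg'.three_le
  have h4' := hg'.lt' h
  refine h.not_one_gap_succ hc hg' (h.outN_one_almost hc (h.u_gap_succ hc hg)
    (h.u_gap_succ hc hg') ?_ ?_ ?_ (h.not_one_gap_succ hc hg))
  · exact (C.ne_of_lt (by omega) (by omega)).symm
  · exact (C.ne_of_lt (by omega) (by omega)).symm
  · intro he
    have := C.inj _ h4 _ h4' he
    omega

/-- The count of `one_u` one step further: otherwise the out-neighbours of `c 2` lie among `c 3` and
those of `c 0` other than `c 1`, `c 2`. -/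
theorem two_zero (h : LongGap r m u c) (hc : Crit r m) (h2 : ¬ r (c 2) u) : r (c 2) (c 0) := by
  classical
  by_contra h0
  have hm := h.two_le
  have C := h.mis.cyc
  have hm3 : 3 < 2 * m := by
    rcases Nat.lt_or_ge 3 (2 * m) with h4 | h4
    · exact h4
    · omega
  have hsub : outN r (c 2) ⊆ insert (c 3) (outN r (c 0) \ {c 1, c 2}) := by
    intro v hv
    rw [mem_outN] at hv
    rcases h.cases_vertex hc v with rfl | ⟨i, hi, rfl⟩
    · exact absurd hv h2
    · rcases Nat.lt_or_ge i 4 with h3 | h3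
      · interval_cases i
        · exact absurd hv h0
        · exact absurd hv (h.not_adj_one hc le_rfl (by omega) h2)
        · exact absurd hv (hc.irr _)
        · exact Finset.mem_insert_self _ _
      · refine Finset.mem_insert_of_mem ?_
        rw [Finset.mem_sdiff, mem_outN, Finset.mem_insert, Finset.mem_singleton]
        refine ⟨?_, ?_⟩
        · by_contra h4
          refine h.forward_of_u hc (by omega) h3 hi ((h.u_iff hc (by omega)).2 h2) ?_ hv
          have := (h.arc_iff_zero hc (j := i - 1) (by omega) (by omega)).2
          rw [show i - 1 + 1 = i by omega] at this
          exact this h4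
        · rintro (h4 | h4)
          · exact C.ne_of_lt (by omega) (by omega) h4.symm
          · exact C.ne_of_lt (by omega) (by omega) h4.symm
  have h5 := Finset.card_le_card hsub
  have h6 := Finset.card_insert_le (c 3) (outN r (c 0) \ {c 1, c 2})
  have h7 : ({c 1, c 2} : Finset V) ⊆ outN r (c 0) := by
    intro v hv
    rw [Finset.mem_insert, Finset.mem_singleton] at hv
    rcases hv with rfl | rfl
    · rw [mem_outN]; exact C.adj 0
    · rw [mem_outN]; exact h.zero_two hc
  rw [Finset.card_sdiff_of_subset h7, h.outN_zero_card hc,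
    Finset.card_pair (C.ne_of_lt (by omega) (by omega))] at h6
  have := hc.out (c 2)
  omega

end LongGap

end ArcDisjoint

/-! ### Long gaps do not exist for `m ≥ 4`; a normal form for `m = 3`. -/

namespace ArcDisjoint

variable {V : Type*} {r : V → V → Prop} {m : ℕ} {u : V} {c : ℕ → V}

open Classical in
/-- The indices below `2 * m` of the non-in-neighbours of `u`. -/
noncomputable def zeros (r : V → V → Prop) (m : ℕ) (u : V) (c : ℕ → V) : Finset ℕ :=
  (Finset.range (2 * m)).filter fun i => ¬ r (c i) u

theorem mem_zeros {i : ℕ} : i ∈ zeros r m u c ↔ i < 2 * m ∧ ¬ r (c i) u := by simp [zeros]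

variable [Fintype V]

theorem zeros_card (h : Mis r m u c) (hc : Crit r m) : (zeros r m u c).card = m :=
  (h.counts hc).2.2.2

namespace LongGap

variable {g : ℕ}

/-- Here `u` replaces `c g` and the cycle is re-indexed from `c 1`. The arcs `c 0 → c g` and
non-arcs `c 1 → c g`, `c 2 → c 1` make this a long gap again. -/
theorem shift_one (h : LongGap r m u c) (hc : Crit r m) (hg : GapAt r m u c g)
    (h21 : ¬ r (c 2) (c 1)) :
    ∃ d, LongGap r m (c g) d ∧ d 0 = c 1 ∧
      ∀ i, 0 < i → i < 2 * m → d i = if i + 1 = g then u else c (i + 1) := by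
  have h3 := hg.three_le
  have h4 := hg.lt' h
  have eg : g - 1 + 1 = g := by omega
  obtain ⟨d, e1, e2, e3⟩ := h.mis.swap hc (g := g - 1) hg.pred (by rw [eg]; exact hg.not)
  rw [eg] at e1 e3
  have v0 : d (2 * m + 1 - g + 0) = c 1 := by
    rw [e3 _ (by omega) (by omega), show g + (2 * m + 1 - g + 0) = 1 + 2 * m by omega,
      h.mis.cyc.per]
  have v : ∀ i, 0 < i → i < 2 * m →
      d (2 * m + 1 - g + i) = if i + 1 = g then u else c (i + 1) := by
    intro i h0 hi
    split_ifs with hig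
    · rw [show 2 * m + 1 - g + i = 0 + 2 * m by omega, e1.cyc.per, e2]
    · rcases Nat.lt_or_ge (i + 1) g with hl | hl
      · rw [e3 _ (by omega) (by omega), show g + (2 * m + 1 - g + i) = i + 1 + 2 * m by omega,
          h.mis.cyc.per]
      · rw [show 2 * m + 1 - g + i = i + 1 - g + 2 * m by omega, e1.cyc.per,
          e3 _ (by omega) (by omega)]
        congr 1; omega
  refine ⟨fun i => d (2 * m + 1 - g + i), ⟨e1.shift _, ?_, ?_, ?_⟩, v0, v⟩
  · show ¬ r (d (2 * m + 1 - g + 0)) (c g)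
    rw [v0]; exact h.not_one_gap hc hg
  · show r (d (2 * m + 1 - g + (2 * m - 1))) (c g)
    rw [v _ (by omega) (by omega), if_neg (by omega),
      show 2 * m - 1 + 1 = 0 + 2 * m by omega, h.mis.cyc.per]
    exact h.zero_gap hc hg
  · show ¬ r (d (2 * m + 1 - g + 1)) (d (2 * m + 1 - g + 0))
    rw [v0, v 1 (by omega) (by omega), if_neg (by omega)]
    exact h21

theorem next_gap (h : LongGap r m u c) (hc : Crit r m) (hg : GapAt r m u c g)
    (h1 : ¬ r (c (g + 1)) u) :
    ∃ d, LongGap r m (c g) d ∧ d 0 = u ∧ ∀ i, 0 < i → i < 2 * m → d i = c (g + i) := by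
  have h3 := hg.three_le
  have eg : g - 1 + 1 = g := by omega
  obtain ⟨d, e1, e2, e3⟩ := h.mis.longGap hc (g := g - 1) hg.pred (by rw [eg]; exact hg.not)
    (by rw [show g - 1 + 2 = g + 1 by omega]; exact h1)
  rw [eg] at e1 e3
  exact ⟨d, e1, e2, e3⟩

theorem next_two (h : LongGap r m u c) (hc : Crit r m) (h2 : ¬ r (c 2) u) (h3 : ¬ r (c 3) u) :
    ∃ d, LongGap r m (c 2) d ∧ d 0 = u ∧ ∀ i, 0 < i → i < 2 * m → d i = c (2 + i) :=
  h.mis.longGap hc (g := 1) (h.one_u hc) h2 h3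

/-- If `c 2` is an in-neighbour of `u`, then all other non-in-neighbours of `u` but `c 0` are
consecutive. -/
theorem block (h : LongGap r m u c) (hc : Crit r m) (h2 : r (c 2) u) :
    ∃ g, GapAt r m u c g ∧ g ≤ m ∧
      ∀ i, 0 < i → i < 2 * m → (¬ r (c i) u ↔ g ≤ i ∧ i ≤ g + m - 2) := by
  classical
  have hm := h.two_le
  have hz := zeros_card h.mis hc
  have h0 : 0 ∈ zeros r m u c := mem_zeros.2 ⟨by omega, h.zero⟩
  have hz' : ((zeros r m u c).erase 0).card = m - 1 := by rw [Finset.card_erase_of_mem h0, hz]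
  have hex : ∃ i, 0 < i ∧ i < 2 * m ∧ ¬ r (c i) u := by
    obtain ⟨i, hi⟩ := Finset.card_pos.1 (show 0 < ((zeros r m u c).erase 0).card by omega)
    rw [Finset.mem_erase, mem_zeros] at hi
    exact ⟨i, by omega, hi.2⟩
  obtain ⟨g1, g2, g3⟩ := Nat.find_spec hex
  have gmin := fun i => Nat.find_min hex (m := i)
  set g := Nat.find hex with hgdef
  have hg3 : 3 ≤ g := by
    by_contra hlt
    have : g = 1 ∨ g = 2 := by omega
    rcases this with e | e
    · rw [e] at g3; exact g3 (h.one_u hc)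
    · rw [e] at g3; exact g3 h2
  have hg : GapAt r m u c g := by
    refine ⟨hg3, g2, ?_, g3⟩
    by_contra h4
    exact gmin (g - 1) (by omega) ⟨by omega, by omega, h4⟩
  -- An in-neighbour just before a non-in-neighbour beyond `g` would start a second later gap, so
  -- non-in-neighbours propagate down to `g`.
  have down : ∀ k z, z = g + k → z < 2 * m → ¬ r (c z) u → ∀ j, g ≤ j → j ≤ z → ¬ r (c j) u := by
    intro k
    induction k with
    | zero =>
      intro z hz _ hb j hj1 hj2
      rwa [show j = z by omega]
    | succ k ih =>
      intro z hz hlt hb j hj1 hj2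
      rcases Nat.lt_or_ge j z with hl | hl
      · refine ih (z - 1) (by omega) (by omega) ?_ j hj1 (by omega)
        intro hpred
        have := h.gap_unique hc hg ⟨by omega, hlt, hpred, hb⟩
        omega
      · rwa [show j = z by omega]
  have hsub : (zeros r m u c).erase 0 ⊆ Finset.Icc g (g + m - 2) := by
    intro z hzz
    rw [Finset.mem_erase, mem_zeros] at hzz
    have hgz : g ≤ z := by
      by_contra hlt
      exact gmin z (by omega) ⟨by omega, hzz.2⟩
    have hI : Finset.Icc g z ⊆ (zeros r m u c).erase 0 := by
      intro j hj
      rw [Finset.mem_Icc] at hj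
      rw [Finset.mem_erase, mem_zeros]
      exact ⟨by omega, by omega, down (z - g) z (by omega) hzz.2.1 hzz.2.2 j hj.1 hj.2⟩
    have := Finset.card_le_card hI
    rw [Nat.card_Icc] at this
    rw [Finset.mem_Icc]
    omega
  have heq : (zeros r m u c).erase 0 = Finset.Icc g (g + m - 2) := by
    apply Finset.eq_of_subset_of_card_le hsub
    rw [Nat.card_Icc]; omega
  have hiff : ∀ i, 0 < i → i < 2 * m → (¬ r (c i) u ↔ g ≤ i ∧ i ≤ g + m - 2) := by
    intro i h0 hi
    rw [← Finset.mem_Icc, ← heq, Finset.mem_erase, mem_zeros]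
    constructor
    · intro h1; exact ⟨by omega, hi, h1⟩
    · intro h1; exact h1.2.2
  refine ⟨g, hg, ?_, hiff⟩
  have hmem : g + m - 2 ∈ (zeros r m u c).erase 0 := by
    rw [heq, Finset.mem_Icc]; omega
  rw [Finset.mem_erase, mem_zeros] at hmem
  -- The block cannot contain the last index, whose vertex is an in-neighbour of `u`; this gives `g
  -- ≤ m`.
  have : g + m - 2 ≠ 2 * m - 1 := by
    intro e
    rw [e] at hmem
    exact hmem.2.2 h.last
  omega

/-- Otherwise the remaining non-in-neighbours form one block of length at least three. Swapping `u`
with the head `c g` gives a long gap to which `block` applies again, so its later gap starts at most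
at `m`. But `c 0 → c g` and the non-arc `c 1 → c g` place that gap at `2 * m - g + 1 > m`. -/
theorem not_two_u (hm : 4 ≤ m) (h : LongGap r m u c) (hc : Crit r m) : ¬ r (c 2) u := by
  intro h2
  obtain ⟨g, hg, hgm, hiff⟩ := h.block hc h2
  have h3 := hg.three_le
  have hb1 : ¬ r (c (g + 1)) u := (hiff _ (by omega) (by omega)).2 (by omega)
  have hb2 : ¬ r (c (g + 2)) u := (hiff _ (by omega) (by omega)).2 (by omega)
  obtain ⟨d, k, d0, dv⟩ := h.next_gap hc hg hb1
  have k2 : r (d 2) (c g) := by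
    by_contra k2
    have := k.two_zero hc k2
    rw [d0, dv 2 (by omega) (by omega)] at this
    exact hb2 this
  obtain ⟨g', hg', hgm', -⟩ := k.block hc k2
  have e0 : d (2 * m - g + 1 - 1) = c 0 := by
    rw [dv _ (by omega) (by omega), show g + (2 * m - g + 1 - 1) = 0 + 2 * m by omega,
      h.mis.cyc.per]
  have e1 : d (2 * m - g + 1) = c 1 := by
    rw [dv _ (by omega) (by omega), show g + (2 * m - g + 1) = 1 + 2 * m by omega,
      h.mis.cyc.per]
  have := k.gap_unique hc (g' := 2 * m - g + 1) hg'
    ⟨by omega, by omega, by rw [e0]; exact h.zero_gap hc hg,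
    by rw [e1]; exact h.not_one_gap hc hg⟩
  omega

/-- If the later gap had a second vertex, two long gaps with missing vertex `c g` would arise. The
one starting at `c 1` shows `c 2 → c g` and not `c 3 → c g`; the one starting at `u` then has later
gaps at both `c 1` and `c 3`. -/
theorem gap_succ_u (hm : 4 ≤ m) (h : LongGap r m u c) (hc : Crit r m) (hg : GapAt r m u c g) :
    r (c (g + 1)) u := by
  by_contra h1
  have h2 := h.not_two_u hm hc
  have h4 : 4 ≤ g := by
    have := hg.three_le
    rcases Nat.lt_or_ge g 4 with h | h
    · have hp := hg.pred
      rw [show g - 1 = 2 by omega] at hp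
      exact absurd hp h2
    · exact h
  have hlt := hg.lt' h
  obtain ⟨d, k, d0, dv⟩ := h.next_gap hc hg h1
  obtain ⟨f, k', f0, fv⟩ := h.shift_one hc hg (h.not_adj_one hc le_rfl (by omega) h2)
  have y2 : r (c 2) (c g) := by
    have := k'.one_u hc
    rwa [fv 1 (by omega) (by omega), if_neg (by omega)] at this
  have y3 : ¬ r (c 3) (c g) := by
    have := k'.not_two_u hm hc
    rwa [fv 2 (by omega) (by omega), if_neg (by omega)] at this
  have e : ∀ j, j < g → d (2 * m - g + j) = c j := by
    intro j hj
    rw [dv _ (by omega) (by omega), show g + (2 * m - g + j) = j + 2 * m by omega,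
      h.mis.cyc.per]
  have := k.gap_unique hc (g := 2 * m - g + 1) (g' := 2 * m - g + 3)
    ⟨by omega, by omega, by
      rw [show 2 * m - g + 1 - 1 = 2 * m - g + 0 by omega, e 0 (by omega)]
      exact h.zero_gap hc hg, by rw [e 1 (by omega)]; exact h.not_one_gap hc hg⟩
    ⟨by omega, by omega, by
      rw [show 2 * m - g + 3 - 1 = 2 * m - g + 2 by omega, e 2 (by omega)]
      exact y2, by rw [e 3 (by omega)]; exact y3⟩
  omega

/-- The run starting at `c 2` has at most two vertices, since a third would contradict `two_zero`
after a swap; any run starting later is a single vertex by `gap_succ_u`. -/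
theorem pred_u_of_not (hm : 4 ≤ m) (h : LongGap r m u c) (hc : Crit r m) :
    ∀ z, 4 ≤ z → z < 2 * m → ¬ r (c z) u → r (c (z - 1)) u := by
  intro z hz
  induction z, hz using Nat.le_induction with
  | base =>
    intro _ h4
    by_contra h3
    obtain ⟨d, k, d0, dv⟩ := h.next_two hc (h.not_two_u hm hc) h3
    have := k.two_zero hc (k.not_two_u hm hc)
    rw [d0, dv 2 (by omega) (by omega)] at this
    exact h4 this
  | succ z hz ih =>
    intro hlt hb
    by_contra hp
    rw [Nat.add_sub_cancel] at hp
    exact hb (h.gap_succ_u hm hc ⟨by omega, by omega, ih (by omega) hp, hp⟩)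

/-- The indices of the `m` non-in-neighbours lie in `{0, 2, 3, g}` with `g` the only later gap, so
`m = 4` and all four occur. -/
theorem eq_four (hm : 4 ≤ m) (h : LongGap r m u c) (hc : Crit r m) :
    m = 4 ∧ ¬ r (c 3) u ∧ ∃ g, GapAt r m u c g ∧ 5 ≤ g := by
  classical
  have hz := zeros_card h.mis hc
  have hgap : ∀ z ∈ zeros r m u c, 4 ≤ z → GapAt r m u c z := by
    intro z hz h4
    rw [mem_zeros] at hz
    exact ⟨by omega, hz.1, h.pred_u_of_not hm hc z h4 hz.1 hz.2, hz.2⟩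
  have hsmall : ∀ z ∈ zeros r m u c, z < 4 → z = 0 ∨ z = 2 ∨ z = 3 := by
    intro z hz h4
    rw [mem_zeros] at hz
    have : z ≠ 1 := by rintro rfl; exact hz.2 (h.one_u hc)
    omega
  by_cases hex : ∃ g ∈ zeros r m u c, 4 ≤ g
  · obtain ⟨g, hgz, hg4⟩ := hex
    have hg := hgap g hgz hg4
    have hsub : zeros r m u c ⊆ {0, 2, 3, g} := by
      intro z hz
      simp only [Finset.mem_insert, Finset.mem_singleton]
      rcases Nat.lt_or_ge z 4 with hl | hl
      · have := hsmall z hz hl; omega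
      · have := h.gap_unique hc (hgap z hz hl) hg; omega
    have hcard : ({0, 2, 3, g} : Finset ℕ).card ≤ 4 := Finset.card_le_four
    have hle := Finset.card_le_card hsub
    have heq := Finset.eq_of_subset_of_card_le hsub (by omega)
    have h3 : 3 ∈ zeros r m u c := by rw [heq]; simp
    rw [mem_zeros] at h3
    refine ⟨by omega, h3.2, g, hg, ?_⟩
    have : g ≠ 4 := by
      rintro rfl
      exact h3.2 hg.pred
    omega
  · exfalso
    have hsub : zeros r m u c ⊆ {0, 2, 3} := by
      intro z hz
      simp only [Finset.mem_insert, Finset.mem_singleton]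
      exact hsmall z hz (by by_contra hl; exact hex ⟨z, hz, by omega⟩)
    have hle := Finset.card_le_card hsub
    have hcard : ({0, 2, 3} : Finset ℕ).card ≤ 3 := Finset.card_le_three
    omega

/-- Only `5` and `6` are left. If it were `5`, then `c 5 → c 2` by `gap_two`, while `eq_four` for
the long gap with missing vertex `c 2` forbids this arc. -/
theorem gapAt_six (hm : 4 ≤ m) (h : LongGap r m u c) (hc : Crit r m) : GapAt r m u c 6 := by
  obtain ⟨rfl, h3, g, hg, hg5⟩ := h.eq_four hm hc
  have hlt := hg.lt' h
  obtain rfl | rfl : g = 5 ∨ g = 6 := by omega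
  · obtain ⟨d, k, d0, dv⟩ := h.next_two hc (h.not_two_u hm hc) h3
    have := (k.eq_four hm hc).2.1
    rw [dv 3 (by omega) (by omega)] at this
    exact absurd (h.gap_two hc hg) this
  · exact hg

/-- In the long gap with missing vertex `c 2`, index `6` is `c 8 = c 0`; its gap there contradicts
`c 0 → c 2`. -/
theorem lt_four (hm : 4 ≤ m) (h : LongGap r m u c) (hc : Crit r m) : False := by
  obtain ⟨rfl, h3, -⟩ := h.eq_four hm hc
  obtain ⟨d, k, d0, dv⟩ := h.next_two hc (h.not_two_u hm hc) h3
  have := (k.gapAt_six hm hc).not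
  rw [dv 6 (by omega) (by omega), show 2 + 6 = 0 + 2 * 4 by omega, h.mis.cyc.per] at this
  exact this (h.zero_two hc)

theorem two_zero_of_three (h : LongGap r 3 u c) (hc : Crit r 3) (h2 : r (c 2) u) :
    ¬ r (c 2) (c 0) := by
  obtain ⟨g, hg, hgm, -⟩ := h.block hc h2
  have h3 := hg.three_le
  obtain rfl : g = 3 := by omega
  exact h.not_gap_pred_zero hc hg

/-- On seven vertices, exactly one further non-in-neighbour of `u` exists beside `c 0`, `c 2`. -/
theorem three_xor_four (h : LongGap r 3 u c) (hc : Crit r 3) (h2 : ¬ r (c 2) u) :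
    (¬ r (c 3) u ∧ r (c 4) u) ∨ (r (c 3) u ∧ ¬ r (c 4) u) := by
  classical
  have hz := zeros_card h.mis hc
  have h1 := h.one_u hc
  have h0 := h.zero
  have h5 : r (c 5) u := h.last
  have e : zeros r 3 u c = {0, 2} ∪ ({3, 4} : Finset ℕ).filter fun i => ¬ r (c i) u := by
    ext i
    rw [mem_zeros]
    simp only [Finset.mem_union, Finset.mem_insert, Finset.mem_singleton, Finset.mem_filter]
    constructor
    · rintro ⟨hi, hb⟩
      have : i < 6 := by omega
      interval_cases i <;> simp_all
    · rintro ((rfl | rfl) | ⟨rfl | rfl, hb⟩)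
      · exact ⟨by omega, h0⟩
      · exact ⟨by omega, h2⟩
      · exact ⟨by omega, hb⟩
      · exact ⟨by omega, hb⟩
  rw [e] at hz
  by_cases h3 : r (c 3) u <;> by_cases h4 : r (c 4) u
  · simp [Finset.filter_insert, Finset.filter_singleton, h3, h4] at hz
  · exact Or.inr ⟨h3, h4⟩
  · exact Or.inl ⟨h3, h4⟩
  · simp [Finset.filter_insert, Finset.filter_singleton, h3, h4] at hz

/-- If `c 2 → c 0`, the non-in-neighbours of `u` have indices `0, 2, 3` or `0, 2, 4`. The first
pattern is refuted by passing twice to the next long gap; for the second, `shift_one` at `g = 4`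
gives the required one, as `c 3` misses `c 1`. -/
theorem exists_longer_of_three (h : LongGap r 3 u c) (hc : Crit r 3) :
    ∃ u' c', LongGap r 3 u' c' ∧ ¬ r (c' 2) (c' 0) := by
  by_cases a2 : r (c 2) (c 0)
  swap
  · exact ⟨u, c, h, a2⟩
  have b2 : ¬ r (c 2) u := fun h2 => h.two_zero_of_three hc h2 a2
  rcases h.three_xor_four hc b2 with ⟨b3, b4⟩ | ⟨b3, b4⟩
  · exfalso
    obtain ⟨d, k, d0, dv⟩ := h.next_two hc b2 b3
    have d1 : d 1 = c 3 := dv 1 (by omega) (by omega)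
    have d2 : d 2 = c 4 := dv 2 (by omega) (by omega)
    have d3 : d 3 = c 5 := dv 3 (by omega) (by omega)
    have d4 : d 4 = c 0 := (dv 4 (by omega) (by omega)).trans (h.mis.cyc.per 0)
    have x2 : ¬ r (d 2) (c 2) := fun hx => k.two_zero_of_three hc hx (by rw [d2, d0]; exact b4)
    have x3 : ¬ r (d 3) (c 2) := by
      rcases k.three_xor_four hc x2 with hx | hx
      · exact hx.1
      · rw [d4] at hx
        exact absurd (h.zero_two hc) hx.2
    obtain ⟨f, k', f0, fv⟩ := k.next_two hc x2 x3
    have f1 : f 1 = c 5 := (fv 1 (by omega) (by omega)).trans d3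
    have f2 : f 2 = c 0 := (fv 2 (by omega) (by omega)).trans d4
    have z2 : ¬ r (f 2) (d 2) := fun hx => k'.two_zero_of_three hc hx (by
      rw [f2, f0]; exact h.zero_two hc)
    have z1 := k'.not_adj_one hc le_rfl (by omega) z2
    rw [f1, f2] at z1
    have x5 : r (c 2) (c 5) := by
      have := (k.u_iff hc (j := 3) (by omega)).2 x2
      rwa [d3] at this
    have a4 : ¬ r (c 4) (c 0) := fun h4 =>
      h.forward_of_u hc (j := 2) (i := 5) (by omega) (by omega) (by omega)
        ((h.u_iff hc (j := 3) (by omega)).2 b2) h4 x5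
    rw [h.arc_iff_zero hc (j := 4) (by omega) (by omega), not_not] at a4
    exact z1 a4
  · have hg : GapAt r 3 u c 4 := ⟨by omega, by omega, b3, b4⟩
    obtain ⟨f, k', f0, fv⟩ := h.shift_one hc hg (h.not_adj_one hc le_rfl (by omega) b2)
    refine ⟨_, f, k', ?_⟩
    rw [f0, fv 2 (by omega) (by omega), if_neg (by omega)]
    exact h.not_gap_pred_one hc hg

end LongGap

end ArcDisjoint

/-! ### The exceptional digraphs on five and seven vertices. -/

namespace ArcDisjoint

variable {V : Type*} {r : V → V → Prop} [Fintype V] {m : ℕ} {u : V} {c : ℕ → V}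

/-- Out-neighbourhoods of the exceptional digraph on five vertices. -/
def fiveArcs : Fin 5 → List (Fin 5) := ![[1, 2], [4, 2], [3, 0], [4, 0], [1, 3]]

/-- Out-neighbourhoods of the exceptional digraph on seven vertices. -/
def sevenArcs : Fin 7 → List (Fin 7) :=
  ![[1, 2, 3], [6, 2, 5], [4, 6, 3], [4, 2, 0], [5, 3, 0], [6, 1, 0], [1, 4, 5]]

theorem LongGap.exists_five (h : LongGap r 2 u c) (hc : Crit r 2) :
    ∃ f : Fin 5 → V, Function.Injective f ∧ ∀ i, ∀ j ∈ fiveArcs i, r (f i) (f j) := by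
  classical
  have C := h.mis.cyc
  have b1 := h.one_u hc
  have b3 : r (c 3) u := h.last
  have b2 : ¬ r (c 2) u := by
    intro b2
    have hsub : zeros r 2 u c ⊆ {0} := by
      intro i hi
      rw [mem_zeros] at hi
      have : i < 4 := by omega
      interval_cases i <;> simp_all
    have := Finset.card_le_card hsub
    rw [zeros_card h.mis hc, Finset.card_singleton] at this
    omega
  have a2 := h.two_zero hc b2
  have u3 : r u (c 3) := (h.u_iff hc (j := 3) (by omega)).2 b2
  have hnd := h.mis.base_nodup 0
  refine ⟨![c 0, c 1, c 2, c 3, u], ?_, ?_⟩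
  · rw [← List.nodup_ofFn]
    refine List.Perm.nodup (l := u :: seg c 0 (2 * 2)) ?_ hnd
    exact (List.perm_append_singleton u [c 0, c 1, c 2, c 3]).symm
  · intro i j hj
    have c34 : r (c 3) (c 0) := h.last_zero
    have c01 := C.adj 0
    have c12 := C.adj 1
    have c23 := C.adj 2
    have c02 := h.zero_two hc
    have u1 := h.u_adj_one hc
    fin_cases i <;> simp [fiveArcs] at hj <;> rcases hj with rfl | rfl <;> assumption

theorem LongGap.exists_seven (h : LongGap r 3 u c) (hc : Crit r 3) :
    ∃ f : Fin 7 → V, Function.Injective f ∧ ∀ i, ∀ j ∈ sevenArcs i, r (f i) (f j) := by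
  classical
  obtain ⟨u, c, h, a2⟩ := h.exists_longer_of_three hc
  have C := h.mis.cyc
  have c01 := C.adj 0
  have c12 := C.adj 1
  have c23 := C.adj 2
  have c34 := C.adj 3
  have c45 := C.adj 4
  have c50 : r (c 5) (c 0) := h.last_zero
  have c02 := h.zero_two hc
  have b1 := h.one_u hc
  have b5 : r (c 5) u := h.last
  have b2 : r (c 2) u := by
    by_contra b2; exact a2 (h.two_zero hc b2)
  obtain ⟨g, hg, hgm, hiff⟩ := h.block hc b2
  obtain rfl : g = 3 := by have := hg.three_le; omega
  have b4 : ¬ r (c 4) u := (hiff 4 (by omega) (by omega)).2 (by omega)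
  have u1 := h.u_adj_one hc
  have u4 : r u (c 4) := h.u_gap_succ hc hg
  have u5 : r u (c 5) := (h.u_iff hc (j := 5) (by omega)).2 b4
  have c03 := h.zero_gap hc hg
  have c32 := h.gap_two hc hg
  have n14 : ¬ r (c 1) (c 4) := h.not_one_gap_succ hc hg
  have c15 : r (c 1) (c 5) := h.outN_one_almost hc u4 u5
    (C.ne_of_lt (by omega) (by omega)).symm (C.ne_of_lt (by omega) (by omega)).symm
    (C.ne_of_lt (by omega) (by omega)) n14
  have n21 : ¬ r (c 2) (c 1) := h.not_gap_pred_one hc hg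
  have n31 := h.not_adj_one hc (j := 3) (by omega) (by omega) hg.not
  have n41 := h.not_adj_one hc (j := 4) (by omega) (by omega) b4
  have c51 : r (c 5) (c 1) := by
    by_contra n51
    have hsub : inN r (c 1) ⊆ {c 0, u} := by
      intro v hv
      rw [mem_inN] at hv
      rcases h.cases_vertex hc v with rfl | ⟨i, hi, rfl⟩
      · simp
      · have : i < 6 := by omega
        interval_cases i
        · simp
        · exact absurd hv (hc.irr _)
        · exact absurd hv n21
        · exact absurd hv n31
        · exact absurd hv n41
        · exact absurd hv n51
    have := (hc.inn (c 1)).trans ((Finset.card_le_card hsub).trans Finset.card_le_two)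
    omega
  obtain ⟨d, k, d0, dv⟩ := h.mis_zero hc
  -- On the cycle missing `c 0`, the vertices `u`, `c 1`, `c 2` already account for all three
  -- non-in-neighbours of `c 0`.
  have hz : ∀ i, i < 6 → ¬ r (d i) (c 0) → i = 0 ∨ i = 1 ∨ i = 2 := by
    have hsub : ({0, 1, 2} : Finset ℕ) ⊆ zeros r 3 (c 0) d := by
      intro i hi
      simp only [Finset.mem_insert, Finset.mem_singleton] at hi
      rw [mem_zeros]
      rcases hi with rfl | rfl | rfl
      · rw [d0]; exact ⟨by omega, h.not_u_zero hc⟩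
      · rw [dv 1 (by omega) (by omega)]; exact ⟨by omega, h.long⟩
      · rw [dv 2 (by omega) (by omega)]; exact ⟨by omega, a2⟩
    have heq := Finset.eq_of_subset_of_card_le hsub (by rw [zeros_card k hc]; rfl)
    intro i hi hb
    have : i ∈ zeros r 3 (c 0) d := mem_zeros.2 ⟨by omega, hb⟩
    rw [← heq] at this
    simpa using this
  have c30 : r (c 3) (c 0) := by
    by_contra hn
    rw [← dv 3 (by omega) (by omega)] at hn
    have := hz 3 (by omega) hn
    omega
  have c40 : r (c 4) (c 0) := by
    by_contra hn
    rw [← dv 4 (by omega) (by omega)] at hn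
    have := hz 4 (by omega) hn
    omega
  have c43 : r (c 4) (c 3) := by
    obtain ⟨f, k', -, fv⟩ := h.next_gap hc hg b4
    have := k'.one_u hc
    rwa [fv 1 (by omega) (by omega)] at this
  have n54 : ¬ r (c 5) (c 4) := by
    intro h54
    refine h.mis.not_cycle_of_perm hc (l := [c 2, u, c 5, c 4, c 3, c 0, c 1]) (a := c 2)
      (b := c 1) ?_ ?_ c12
    · rw [List.perm_iff_count]
      intro a
      simp only [seg, List.range_succ, List.range_zero, List.map_append, List.map_cons,
        List.map_nil, List.count_append, List.count_cons, List.count_nil, Nat.zero_add]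
      ring
    · exact IsWalk.cons b2 <| IsWalk.cons u5 <| IsWalk.cons h54 <| IsWalk.cons c43 <|
        IsWalk.cons c30 <| IsWalk.cons c01 <| IsWalk.single _
  have n04 : ¬ r (c 0) (c 4) := (h.arc_iff_zero hc (j := 3) (by omega) (by omega)).1 c30
  have c24 : r (c 2) (c 4) := by
    by_contra n24
    have hsub : inN r (c 4) ⊆ {c 3, u} := by
      intro v hv
      rw [mem_inN] at hv
      rcases h.cases_vertex hc v with rfl | ⟨i, hi, rfl⟩
      · simp
      · have : i < 6 := by omega
        interval_cases i
        · exact absurd hv n04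
        · exact absurd hv n14
        · exact absurd hv n24
        · simp
        · exact absurd hv (hc.irr _)
        · exact absurd hv n54
    have := (hc.inn (c 4)).trans ((Finset.card_le_card hsub).trans Finset.card_le_two)
    omega
  have hnd := h.mis.base_nodup 0
  refine ⟨![c 0, c 1, c 2, c 3, c 4, c 5, u], ?_, ?_⟩
  · rw [← List.nodup_ofFn]
    refine List.Perm.nodup (l := u :: seg c 0 (2 * 3)) ?_ hnd
    exact (List.perm_append_singleton u [c 0, c 1, c 2, c 3, c 4, c 5]).symm
  · intro i j hj
    fin_cases i <;> simp [sevenArcs] at hj <;> rcases hj with rfl | rfl | rfl <;> assumption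

/-! ### Without long gaps: alternation and an independent set. -/

theorem Mis.succ_of_not (hno : ∀ u c, ¬ LongGap r m u c) (h : Mis r m u c) (hc : Crit r m) {i : ℕ}
    (h1 : ¬ r (c i) u) : r (c (i + 1)) u := by
  by_contra h2
  -- Two consecutive non-in-neighbours spread backwards round the whole cycle, leaving `u` without
  -- in-neighbours.
  have step : ∀ j, ¬ r (c (j + 1)) u → ¬ r (c (j + 2)) u → ¬ r (c j) u := by
    intro j h3 h4 h5
    obtain ⟨d, k, -⟩ := h.longGap hc h5 h3 h4
    exact hno _ _ k
  have hp := h.pos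
  have all : ∀ k, k ≤ i + 2 * m →
      ¬ r (c (i + 2 * m - k)) u ∧ ¬ r (c (i + 2 * m - k + 1)) u := by
    intro k
    induction k with
    | zero =>
      intro _
      rw [Nat.sub_zero, h.cyc.per, show i + 2 * m + 1 = i + 1 + 2 * m by omega, h.cyc.per]
      exact ⟨h1, h2⟩
    | succ k ih =>
      intro hk
      obtain ⟨h3, h4⟩ := ih (by omega)
      rw [show i + 2 * m - (k + 1) + 1 = i + 2 * m - k by omega]
      refine ⟨step _ ?_ ?_, h3⟩
      · rwa [show i + 2 * m - (k + 1) + 1 = i + 2 * m - k by omega]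
      · rwa [show i + 2 * m - (k + 1) + 2 = i + 2 * m - k + 1 by omega]
  have hin := hc.inn u
  obtain ⟨v, hv⟩ := Finset.card_pos.1 (show 0 < (inN r u).card by omega)
  rw [mem_inN] at hv
  have hvu : v ≠ u := by rintro rfl; exact hc.irr _ hv
  obtain ⟨j, hj, rfl⟩ := h.exists_eq hc i hvu
  refine (all (2 * m - j) (by omega)).1 ?_
  rwa [show i + 2 * m - (2 * m - j) = i + j by omega]

theorem Mis.alternating (hno : ∀ u c, ¬ LongGap r m u c) (h : Mis r m u c) (hc : Crit r m)
    (i : ℕ) : r (c i) u ↔ ¬ r (c (i + 1)) u := by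
  classical
  have hp := h.pos
  constructor
  · intro h1 h2
    have hk := h.shift i
    have hz := zeros_card hk hc
    -- Pair the positions as `{2t, 2t + 1}`. Each pair holds at most one of the `m`
    -- non-in-neighbours, and the pair `{0, 1}` holds none, which leaves too little room.
    have hmaps : ∀ z ∈ zeros r m u (fun j => c (i + j)), z / 2 ∈ Finset.Ico 1 m := by
      intro z hz
      rw [mem_zeros] at hz
      have : z ≠ 0 := by rintro rfl; exact hz.2 h1
      have : z ≠ 1 := by rintro rfl; exact hz.2 h2
      rw [Finset.mem_Ico]
      omega
    have hinj : Set.InjOn (fun z => z / 2) (zeros r m u (fun j => c (i + j)) : Set ℕ) := by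
      intro x hx y hy hxy
      rw [Finset.mem_coe, mem_zeros] at hx hy
      have hxy' : x / 2 = y / 2 := hxy
      have hx1 : y ≠ x + 1 := by
        rintro rfl; exact hy.2 (hk.succ_of_not hno hc hx.2)
      have hy1 : x ≠ y + 1 := by
        rintro rfl; exact hx.2 (hk.succ_of_not hno hc hy.2)
      omega
    have := Finset.card_le_card_of_injOn _ hmaps hinj
    rw [hz, Nat.card_Ico] at this
    omega
  · intro h1
    by_contra h2
    exact h1 (h.succ_of_not hno hc h2)

theorem Mis.even_not (hno : ∀ u c, ¬ LongGap r m u c) (h : Mis r m u c) (hc : Crit r m)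
    (h0 : ¬ r (c 0) u) (k : ℕ) : ¬ r (c (2 * k)) u := by
  induction k with
  | zero => exact h0
  | succ k ih =>
    have h1 := h.alternating hno hc (2 * k)
    have h2 := h.alternating hno hc (2 * k + 1)
    rw [show 2 * (k + 1) = 2 * k + 1 + 1 by omega]
    tauto

/-- If no long gaps exist, the cycle missing `u` yields an independent set of `m + 1` vertices. -/
theorem Mis.exists_independent (hno : ∀ u c, ¬ LongGap r m u c) (h : Mis r m u c)
    (hc : Crit r m) :
    ∃ I : Finset V, I.card = m + 1 ∧ ∀ x ∈ I, ∀ y ∈ I, ¬ r x y := by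
  classical
  have hp := h.pos
  wlog h0 : ¬ r (c 0) u generalizing c with H
  · rw [not_not] at h0
    exact H (h.shift 1) ((h.alternating hno hc 0).1 h0)
  have even := h.even_not hno hc h0
  have odd : ∀ k, r (c (2 * k + 1)) u := by
    intro k
    have h1 := h.alternating hno hc (2 * k)
    have h2 := even k
    tauto
  have uout : ∀ k, ¬ r u (c (2 * k)) := by
    intro k
    have h1 := (h.arc_iff hc (2 * (k + m - 1) + 1)).1 (odd _)
    rwa [show 2 * (k + m - 1) + 1 + 1 = 2 * k + 2 * m by omega, h.cyc.per] at h1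
  -- Swap `u` with `c (2 * s)`: the new cycle also alternates around its missing vertex, starting
  -- from the non-in-neighbour `u`. The index `2 * (s + m - 1) + 1` denotes the predecessor of `c (2
  -- * s)`, one turn later to stay nonnegative.
  have between : ∀ s t, s < m → t < m → ¬ r (c (2 * t)) (c (2 * s)) := by
    intro s t hs ht
    rcases eq_or_ne s t with rfl | hst
    · exact hc.irr _
    have hper : ∀ i, c (i + 2 * m) = c i := h.cyc.per
    have e : c (2 * (s + m - 1) + 1 + 1) = c (2 * s) := by
      rw [show 2 * (s + m - 1) + 1 + 1 = 2 * s + 2 * m by omega, hper]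
    obtain ⟨d, k, d0, dv⟩ := h.swap hc (g := 2 * (s + m - 1) + 1) (odd _)
      (by rw [e]; exact even s)
    rw [e] at k
    have key := k.even_not hno hc (by rw [d0]; exact uout s)
    rcases Nat.lt_or_ge s t with hlt | hlt
    · have := key (t - s)
      rwa [dv _ (by omega) (by omega),
        show 2 * (s + m - 1) + 1 + 1 + 2 * (t - s) = 2 * t + 2 * m by omega, hper] at this
    · have := key (m + t - s)
      rwa [dv _ (by omega) (by omega),
        show 2 * (s + m - 1) + 1 + 1 + 2 * (m + t - s) = 2 * t + 2 * m + 2 * m by omega,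
        hper, hper] at this
  refine ⟨insert u ((Finset.range m).image fun t => c (2 * t)), ?_, ?_⟩
  · rw [Finset.card_insert_of_notMem, Finset.card_image_of_injOn, Finset.card_range]
    · intro x hx y hy hxy
      rw [Finset.coe_range, Set.mem_Iio] at hx hy
      have := h.cyc.inj (2 * x) (by omega) (2 * y) (by omega) hxy
      omega
    · rw [Finset.mem_image]
      rintro ⟨t, -, ht⟩
      exact h.ne _ ht
  · intro x hx y hy
    simp only [Finset.mem_insert, Finset.mem_image, Finset.mem_range] at hx hy
    rcases hx with rfl | ⟨s, hs, rfl⟩ <;> rcases hy with rfl | ⟨t, ht, rfl⟩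
    · exact hc.irr _
    · exact uout t
    · exact even s
    · exact between t s ht hs

end ArcDisjoint

/-! ### Longest cycles, paths off them, and Ghouila-Houri's theorem. -/

namespace ArcDisjoint

variable {V : Type*} {r : V → V → Prop}

theorem exists_max_length [Fintype V] {p : List V → Prop} (hp : ∃ l, p l)
    (hn : ∀ l, p l → l.Nodup) : ∃ l, p l ∧ ∀ l', p l' → l'.length ≤ l.length := by
  classical
  obtain ⟨l₀, h₀⟩ := hp
  have hb : ∀ l, p l → l.length ≤ Fintype.card V := fun l hl => (hn l hl).length_le_card
  have hex : ∃ k, ∃ l, p l ∧ l.length + k = Fintype.card V :=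
    ⟨Fintype.card V - l₀.length, l₀, h₀, by have := hb l₀ h₀; omega⟩
  obtain ⟨l, hl, hk⟩ := Nat.find_spec hex
  refine ⟨l, hl, fun l' hl' => ?_⟩
  by_contra hlt
  have h1 := hb l' hl'
  exact Nat.find_min hex (m := Fintype.card V - l'.length) (by omega) ⟨l', hl', by omega⟩

theorem exists_first_of_mem {p : V → Prop} {l : List V} (h : ∃ x ∈ l, p x) :
    ∃ l₁ x l₂, l = l₁ ++ x :: l₂ ∧ p x ∧ ∀ y ∈ l₁, ¬ p y := by
  induction l with
  | nil => simp at h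
  | cons a l ih =>
    by_cases ha : p a
    · exact ⟨[], a, l, rfl, ha, by simp⟩
    · obtain ⟨x, hx, hpx⟩ := h
      have hx' : x ∈ l := by
        rcases List.mem_cons.1 hx with rfl | hx
        · exact absurd hpx ha
        · exact hx
      obtain ⟨l₁, y, l₂, rfl, h2, h3⟩ := ih ⟨x, hx', hpx⟩
      refine ⟨a :: l₁, y, l₂, rfl, h2, ?_⟩
      intro z hz
      rcases List.mem_cons.1 hz with rfl | hz
      · exact ha
      · exact h3 z hz

theorem IsWalk.suffix {a b x : V} {l₁ l₂ : List V} (h : IsWalk r a (l₁ ++ x :: l₂) b) :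
    IsWalk r x (x :: l₂) b := by
  obtain ⟨h1, -, h3⟩ := h
  refine ⟨(List.isChain_append.1 h1).2.1, rfl, ?_⟩
  rw [List.getLast?_append] at h3
  rw [← h3]
  simp [List.getLast?_cons]

theorem IsWalk.mem_left {a b : V} {l : List V} (h : IsWalk r a l b) : a ∈ l :=
  List.mem_of_mem_head? h.2.1

theorem IsWalk.mem_right {a b : V} {l : List V} (h : IsWalk r a l b) : b ∈ l :=
  List.mem_of_mem_getLast? h.2.2

/-- A path outside the set `A` that cannot be extended at either end outside `A`. -/
theorem exists_longest_walk [Fintype V] (r : V → V → Prop) (A : V → Prop) (hA : ∃ v, ¬ A v) :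
    ∃ P a b, IsWalk r a P b ∧ P.Nodup ∧ (∀ v ∈ P, ¬ A v) ∧ (∀ v, ¬ A v → r v a → v ∈ P) ∧
      ∀ v, ¬ A v → r b v → v ∈ P := by
  obtain ⟨v₀, hv₀⟩ := hA
  obtain ⟨P, ⟨a, b, hw, hn, hP⟩, hmax⟩ := exists_max_length
    (p := fun P : List V => ∃ a b, IsWalk r a P b ∧ P.Nodup ∧ ∀ v ∈ P, ¬ A v)
    ⟨[v₀], v₀, v₀, IsWalk.single _, by simp, by simpa using hv₀⟩ (fun l ⟨a, b, h⟩ => h.2.1)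
  refine ⟨P, a, b, hw, hn, hP, ?_, ?_⟩
  · intro v hv hva
    by_contra hvP
    have := hmax (v :: P) ⟨v, b, IsWalk.cons hva hw, List.nodup_cons.2 ⟨hvP, hn⟩, by
      intro x hx
      rcases List.mem_cons.1 hx with rfl | hx
      · exact hv
      · exact hP x hx⟩
    simp at this
  · intro v hv hbv
    by_contra hvP
    have := hmax (P ++ [v]) ⟨a, v, hw.append hbv (IsWalk.single v), by
      rw [List.nodup_append]
      refine ⟨hn, by simp, ?_⟩
      intro x hx y hy
      rw [List.mem_singleton] at hy
      rintro rfl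
      exact hvP (hy ▸ hx), by
      intro x hx
      rcases List.mem_append.1 hx with hx | hx
      · exact hP x hx
      · rw [List.mem_singleton] at hx
        exact hx ▸ hv⟩
    simp at this

/-- All out-neighbours of the end of a longest path lie on the path; closing at the first of them
gives a cycle through all of them and the end itself. -/
theorem exists_long_cycle [Fintype V] [Nonempty V] {δ : ℕ} (hδ : 0 < δ) (hirr : ∀ v, ¬ r v v)
    (hout : ∀ v, δ ≤ (outN r v).card) : ∃ l, IsCycleList r l ∧ δ + 1 ≤ l.length := by
  classical
  obtain ⟨P, a, b, hw, hn, -, -, hb⟩ :=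
    exists_longest_walk r (fun _ => False) ⟨Classical.arbitrary V, not_false⟩
  have hb' : ∀ v, r b v → v ∈ P := fun v => hb v not_false
  obtain ⟨v, hv⟩ := Finset.card_pos.1 (show 0 < (outN r b).card by have := hout b; omega)
  rw [mem_outN] at hv
  obtain ⟨l₁, x, l₂, rfl, hx, hl₁⟩ := exists_first_of_mem ⟨v, hb' v hv, hv⟩
  have hw' := hw.suffix
  have hn' : (x :: l₂).Nodup := (List.nodup_append.1 hn).2.1
  refine ⟨x :: l₂, ⟨hn', x, b, hw', hx⟩, ?_⟩
  have hsub : outN r b ⊆ (x :: l₂).toFinset.erase b := by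
    intro y hy
    rw [mem_outN] at hy
    rw [Finset.mem_erase, List.mem_toFinset]
    refine ⟨by rintro rfl; exact hirr _ hy, ?_⟩
    rcases List.mem_append.1 (hb' y hy) with h | h
    · exact absurd hy (hl₁ y h)
    · exact h
  have h1 := Finset.card_le_card hsub
  rw [Finset.card_erase_of_mem (List.mem_toFinset.2 hw'.mem_right),
    List.toFinset_card_of_nodup hn'] at h1
  have := hout b
  have : 0 < (x :: l₂).length := by simp
  omega

/-- `c` is a longest cycle. -/
structure MaxCyc (r : V → V → Prop) (n : ℕ) (c : ℕ → V) : Prop where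
  cyc : Cyc r n c
  max : ∀ l, IsCycleList r l → l.length ≤ n

theorem MaxCyc.shift {n : ℕ} {c : ℕ → V} (h : MaxCyc r n c) (k : ℕ) :
    MaxCyc r n fun i => c (k + i) := ⟨h.cyc.shift k, h.max⟩

/-- Replacing `d - 1` consecutive vertices of a longest cycle by a path off the cycle cannot
make it longer. -/
theorem MaxCyc.detour {n : ℕ} {c : ℕ → V} (h : MaxCyc r n c) {a b : V} {P : List V}
    (hw : IsWalk r a P b) (hn : P.Nodup) (hoff : ∀ v ∈ P, ∀ i, c i ≠ v) {i d : ℕ} (h1 : 1 ≤ d)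
    (hd : d ≤ n) (ha : r (c i) a) (hb : r b (c (i + d))) : P.length + 1 ≤ d := by
  have := h.max (P ++ seg c (i + d) (n - d + 1)) ⟨?_, a, c (i + d + (n - d)),
    hw.append hb (h.cyc.isWalk _ _), ?_⟩
  · rw [List.length_append, seg_length] at this
    omega
  · rw [List.nodup_append]
    refine ⟨hn, h.cyc.seg_nodup _ (by omega), ?_⟩
    intro x hx y hy
    obtain ⟨j, -, rfl⟩ := mem_seg.1 hy
    exact (hoff x hx _).symm
  · rw [show i + d + (n - d) = i + n by omega, h.cyc.per]
    exact ha

/-- `P` is a path off the cycle `c`, not extendable off the cycle. -/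
structure OffPath (r : V → V → Prop) (c : ℕ → V) (a : V) (P : List V) (b : V) : Prop where
  walk : IsWalk r a P b
  nodup : P.Nodup
  off : ∀ v ∈ P, ∀ i, c i ≠ v
  inn : ∀ v, (∀ i, c i ≠ v) → r v a → v ∈ P
  out : ∀ v, (∀ i, c i ≠ v) → r b v → v ∈ P

theorem OffPath.shift {c : ℕ → V} {a b : V} {P : List V} {n : ℕ} (hc : Cyc r n c)
    (h : OffPath r c a P b) (k : ℕ) : OffPath r (fun i => c (k + i)) a P b := by
  have key : ∀ v, (∀ i, c (k + i) ≠ v) → ∀ i, c i ≠ v := by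
    intro v hv i
    obtain ⟨j, -, hj⟩ := hc.exists_add_eq k i
    rw [← hj]
    exact hv j
  exact ⟨h.walk, h.nodup, fun v hv i => h.off v hv _, fun v hv => h.inn v (key v hv),
    fun v hv => h.out v (key v hv)⟩

section Counting

variable {n k : ℕ} {c : ℕ → V} {a b : V} {P : List V}

/-- The indices in `[0, n)` of the in-neighbours of `a`. -/
noncomputable def inIdx (r : V → V → Prop) (n : ℕ) (c : ℕ → V) (a : V) : Finset ℕ :=
  open Classical in (Finset.range n).filter fun i => r (c i) a

/-- The indices in `[1, n]` of the out-neighbours of `b`. -/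
noncomputable def outIdx (r : V → V → Prop) (n : ℕ) (c : ℕ → V) (b : V) : Finset ℕ :=
  open Classical in (Finset.Icc 1 n).filter fun i => r b (c i)

theorem mem_inIdx {i : ℕ} : i ∈ inIdx r n c a ↔ i < n ∧ r (c i) a := by simp [inIdx]

theorem mem_outIdx {i : ℕ} : i ∈ outIdx r n c b ↔ (1 ≤ i ∧ i ≤ n) ∧ r b (c i) := by
  simp [outIdx]

/-- The path `P` leaves at least `P.length` vertices of the cycle after the in-neighbour `c 0`
of its start. -/
structure GapStart (r : V → V → Prop) (n k : ℕ) (c : ℕ → V) (a b : V) : Prop where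
  le : k + 2 ≤ n
  zero : r (c 0) a
  gap : ∀ j, 1 ≤ j → j ≤ k + 1 → ¬ r (c j) a ∧ ¬ r b (c j)

/-- Shift the in-indices of `a` by one: they become disjoint from the out-indices of `b`, because
the path cannot be inserted between consecutive cycle vertices. Both sets avoid `[2, k + 1]` by the
gap, and all three lie in `[1, n]`. In case of equality they cover it. -/
theorem OffPath.idx_card (hM : MaxCyc r n c) (h : OffPath r c a P b)
    (hs : GapStart r n k c a b) :
    (inIdx r n c a).card + (outIdx r n c b).card + k ≤ n ∧
      ((inIdx r n c a).card + (outIdx r n c b).card + k = n →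
        ∀ i, 1 ≤ i → i ≤ n → ¬ (2 ≤ i ∧ i ≤ k + 1) → ¬ r (c (i - 1)) a → r b (c i)) := by
  classical
  set A := (inIdx r n c a).image (· + 1) with hA
  set B := outIdx r n c b with hB
  have cA : A.card = (inIdx r n c a).card :=
    Finset.card_image_of_injective _ (add_left_injective 1)
  have memA : ∀ i, i ∈ A ↔ 1 ≤ i ∧ i ≤ n ∧ r (c (i - 1)) a := by
    intro i
    rw [hA, Finset.mem_image]
    constructor
    · rintro ⟨j, hj, rfl⟩
      rw [mem_inIdx] at hj
      exact ⟨by omega, by omega, hj.2⟩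
    · rintro ⟨h1, h2, h3⟩
      exact ⟨i - 1, mem_inIdx.2 ⟨by omega, h3⟩, by omega⟩
  have hpos : 0 < P.length := List.length_pos_of_mem h.walk.mem_left
  have dAB : Disjoint A B := by
    rw [Finset.disjoint_left]
    intro i hi hi'
    rw [memA] at hi
    rw [hB, mem_outIdx] at hi'
    have := hM.detour (i := i - 1) (d := 1) h.walk h.nodup h.off le_rfl (by omega) hi.2.2
      (by rw [show i - 1 + 1 = i by omega]; exact hi'.2)
    omega
  have dABI : Disjoint (A ∪ B) (Finset.Icc 2 (k + 1)) := by
    rw [Finset.disjoint_left]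
    intro i hi hi'
    rw [Finset.mem_Icc] at hi'
    rcases Finset.mem_union.1 hi with hi | hi
    · rw [memA] at hi
      exact (hs.gap (i - 1) (by omega) (by omega)).1 hi.2.2
    · rw [hB, mem_outIdx] at hi
      exact (hs.gap i (by omega) (by omega)).2 hi.2
  have hsub : A ∪ B ∪ Finset.Icc 2 (k + 1) ⊆ Finset.Icc 1 n := by
    have := hs.le
    intro i hi
    rw [Finset.mem_Icc]
    rcases Finset.mem_union.1 hi with hi | hi
    · rcases Finset.mem_union.1 hi with hi | hi
      · rw [memA] at hi; omega
      · rw [hB, mem_outIdx] at hi; omega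
    · rw [Finset.mem_Icc] at hi; omega
  have hcard : (A ∪ B ∪ Finset.Icc 2 (k + 1)).card = A.card + B.card + k := by
    rw [Finset.card_union_of_disjoint dABI, Finset.card_union_of_disjoint dAB, Nat.card_Icc]
    omega
  have hle := Finset.card_le_card hsub
  rw [hcard, Nat.card_Icc, cA] at hle
  refine ⟨by omega, fun heq i h1 h2 h3 h4 => ?_⟩
  have huni := Finset.eq_of_subset_of_card_le hsub (by rw [hcard, Nat.card_Icc, cA]; omega)
  have : i ∈ A ∪ B ∪ Finset.Icc 2 (k + 1) := by rw [huni, Finset.mem_Icc]; omega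
  rcases Finset.mem_union.1 this with hi | hi
  · rcases Finset.mem_union.1 hi with hi | hi
    · rw [memA] at hi; exact absurd hi.2.2 h4
    · rw [hB, mem_outIdx] at hi; exact hi.2
  · rw [Finset.mem_Icc] at hi; exact absurd hi h3

variable [Fintype V]

theorem OffPath.length_le (hc : Cyc r n c) (h : OffPath r c a P b) :
    n + P.length ≤ Fintype.card V := by
  have hn : (seg c 0 n ++ P).Nodup := by
    rw [List.nodup_append]
    refine ⟨hc.seg_nodup 0 le_rfl, h.nodup, ?_⟩
    intro x hx y hy
    obtain ⟨j, -, rfl⟩ := mem_seg.1 hx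
    exact h.off y hy _
  have := hn.length_le_card
  rwa [List.length_append, seg_length] at this

/-- Choose an in-neighbour of `a` and a following out-neighbour of `b` at minimal distance along the
cycle. Maximality of the cycle makes this distance at least `k + 2`, and minimality keeps the
interior free. The degree bounds ensure that both kinds of neighbour occur on the cycle. -/
theorem OffPath.exists_shift (hM : MaxCyc r n c) (h : OffPath r c a P b) (hk : P.length = k + 1)
    (hirr : ∀ v, ¬ r v v) (ha : k < (inN r a).card) (hb : k < (outN r b).card) :
    k + 2 ≤ n ∧ ∃ s, r (c s) a ∧ ∀ j, 1 ≤ j → j ≤ k + 1 →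
      ¬ r (c (s + j)) a ∧ ¬ r b (c (s + j)) := by
  classical
  have hn := hM.cyc.pos
  have e1 : ∃ i, r (c i) a := by
    by_contra hno
    push Not at hno
    have hsub : inN r a ⊆ P.toFinset.erase a := by
      intro v hv
      rw [mem_inN] at hv
      rw [Finset.mem_erase, List.mem_toFinset]
      refine ⟨by rintro rfl; exact hirr _ hv, h.inn v (fun i hi => ?_) hv⟩
      subst hi
      exact hno i hv
    have := Finset.card_le_card hsub
    rw [Finset.card_erase_of_mem (List.mem_toFinset.2 h.walk.mem_left),
      List.toFinset_card_of_nodup h.nodup, hk] at this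
    omega
  have e2 : ∃ i, r b (c i) := by
    by_contra hno
    push Not at hno
    have hsub : outN r b ⊆ P.toFinset.erase b := by
      intro v hv
      rw [mem_outN] at hv
      rw [Finset.mem_erase, List.mem_toFinset]
      refine ⟨by rintro rfl; exact hirr _ hv, h.out v (fun i hi => ?_) hv⟩
      subst hi
      exact hno i hv
    have := Finset.card_le_card hsub
    rw [Finset.card_erase_of_mem (List.mem_toFinset.2 h.walk.mem_right),
      List.toFinset_card_of_nodup h.nodup, hk] at this
    omega
  have hex : ∃ d, ∃ i, 1 ≤ d ∧ d ≤ n ∧ r (c i) a ∧ r b (c (i + d)) := by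
    obtain ⟨i, hi⟩ := e1
    obtain ⟨j, hj⟩ := e2
    rw [← hM.cyc.mod i] at hi
    rw [← hM.cyc.mod j] at hj
    have hi' := Nat.mod_lt i hn
    have hj' := Nat.mod_lt j hn
    rcases Nat.lt_or_ge (i % n) (j % n) with hl | hl
    · exact ⟨j % n - i % n, i % n, by omega, by omega, hi, by
        rwa [show i % n + (j % n - i % n) = j % n by omega]⟩
    · exact ⟨j % n + n - i % n, i % n, by omega, by omega, hi, by
        rwa [show i % n + (j % n + n - i % n) = j % n + n by omega, hM.cyc.per]⟩
  obtain ⟨s, h1, h2, h3, h4⟩ := Nat.find_spec hex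
  have hmin := fun d => Nat.find_min hex (m := d)
  set d := Nat.find hex
  have hd := hM.detour h.walk h.nodup h.off h1 h2 h3 h4
  refine ⟨by omega, s, h3, fun j hj1 hj2 => ⟨fun h5 => ?_, fun h5 => ?_⟩⟩
  · refine hmin (d - j) (by omega) ⟨s + j, by omega, by omega, h5, ?_⟩
    rwa [show s + j + (d - j) = s + d by omega]
  · exact hmin j (by omega) ⟨s, hj1, by omega, h3, h5⟩

theorem OffPath.inN_card_le (hM : MaxCyc r n c) (h : OffPath r c a P b) (hk : P.length = k + 1)
    (hirr : ∀ v, ¬ r v v) : (inN r a).card ≤ (inIdx r n c a).card + k := by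
  classical
  have hsub : inN r a ⊆ (inIdx r n c a).image c ∪ P.toFinset.erase a := by
    intro v hv
    rw [mem_inN] at hv
    rw [Finset.mem_union, Finset.mem_image, Finset.mem_erase, List.mem_toFinset]
    by_cases hi : ∃ i, c i = v
    · obtain ⟨i, rfl⟩ := hi
      refine Or.inl ⟨i % n, mem_inIdx.2 ⟨Nat.mod_lt _ hM.cyc.pos, ?_⟩, hM.cyc.mod i⟩
      rwa [hM.cyc.mod]
    · push Not at hi
      exact Or.inr ⟨by rintro rfl; exact hirr _ hv, h.inn v hi hv⟩
  have h1 := (Finset.card_le_card hsub).trans (Finset.card_union_le _ _)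
  have h2 := Finset.card_image_le (s := inIdx r n c a) (f := c)
  rw [Finset.card_erase_of_mem (List.mem_toFinset.2 h.walk.mem_left),
      List.toFinset_card_of_nodup h.nodup, hk] at h1
  omega

theorem OffPath.outN_card_le (hM : MaxCyc r n c) (h : OffPath r c a P b) (hk : P.length = k + 1)
    (hirr : ∀ v, ¬ r v v) : (outN r b).card ≤ (outIdx r n c b).card + k := by
  classical
  have hsub : outN r b ⊆ (outIdx r n c b).image c ∪ P.toFinset.erase b := by
    intro v hv
    rw [mem_outN] at hv
    rw [Finset.mem_union, Finset.mem_image, Finset.mem_erase, List.mem_toFinset]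
    by_cases hi : ∃ i, c i = v
    · obtain ⟨i, rfl⟩ := hi
      left
      have hlt := Nat.mod_lt i hM.cyc.pos
      rcases Nat.eq_zero_or_pos (i % n) with h0 | h0
      · have e : c n = c i := by
          rw [← hM.cyc.mod i, h0, ← hM.cyc.per 0, Nat.zero_add]
        exact ⟨n, mem_outIdx.2 ⟨⟨hM.cyc.pos, le_rfl⟩, by rwa [e]⟩, e⟩
      · exact ⟨i % n, mem_outIdx.2 ⟨⟨h0, hlt.le⟩, by rwa [hM.cyc.mod]⟩, hM.cyc.mod i⟩
    · push Not at hi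
      exact Or.inr ⟨by rintro rfl; exact hirr _ hv, h.out v hi hv⟩
  have h1 := (Finset.card_le_card hsub).trans (Finset.card_union_le _ _)
  have h2 := Finset.card_image_le (s := outIdx r n c b) (f := c)
  rw [Finset.card_erase_of_mem (List.mem_toFinset.2 h.walk.mem_right),
      List.toFinset_card_of_nodup h.nodup, hk] at h1
  omega

end Counting

/-- A longest cycle that is not Hamiltonian, together with a path off it. -/
theorem exists_maxCyc_offPath [Fintype V] [Nonempty V] {δ : ℕ} (hδ : 0 < δ)
    (hirr : ∀ v, ¬ r v v) (hout : ∀ v, δ ≤ (outN r v).card)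
    (hham : ∀ l, IsCycleList r l → l.length ≠ Fintype.card V) :
    ∃ n c a P b, δ + 1 ≤ n ∧ MaxCyc r n c ∧ OffPath r c a P b := by
  classical
  obtain ⟨l₀, h₀, h₀'⟩ := exists_long_cycle hδ hirr hout
  obtain ⟨l, hl, hmax⟩ := exists_max_length (p := IsCycleList r) ⟨l₀, h₀⟩ (fun l hl => hl.1)
  obtain ⟨hn, a, b, hw, hba⟩ := hl
  obtain ⟨c, hc, hseg, -, -⟩ := Cyc.of_list hn hw hba
  have hex : ∃ v, ¬ ∃ i, c i = v := by
    by_contra hno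
    push Not at hno
    refine hham l ⟨hn, a, b, hw, hba⟩ ?_
    rw [← List.toFinset_card_of_nodup hn, Finset.card_eq_iff_eq_univ, Finset.eq_univ_iff_forall]
    intro v
    obtain ⟨i, rfl⟩ := hno v
    rw [List.mem_toFinset, ← hseg, mem_seg]
    exact ⟨i % l.length, Nat.mod_lt _ hc.pos, by rw [Nat.zero_add, hc.mod]⟩
  obtain ⟨P, a', b', h1, h2, h3, h4, h5⟩ := exists_longest_walk r (fun v => ∃ i, c i = v) hex
  refine ⟨l.length, c, a', P, b', h₀'.trans (hmax _ h₀), ⟨hc, hmax⟩, h1, h2, ?_, ?_, ?_⟩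
  · intro v hv i hi
    exact h3 v hv ⟨i, hi⟩
  · intro v hv
    exact h4 v (fun ⟨i, hi⟩ => hv i hi)
  · intro v hv
    exact h5 v (fun ⟨i, hi⟩ => hv i hi)

/-- **Ghouila-Houri's theorem** for semidegrees. -/
theorem exists_hamiltonian [Fintype V] [Nonempty V] {δ : ℕ} (hδ : 0 < δ)
    (hirr : ∀ v, ¬ r v v) (hout : ∀ v, δ ≤ (outN r v).card) (hin : ∀ v, δ ≤ (inN r v).card)
    (hcard : Fintype.card V ≤ 2 * δ) : ∃ l, IsCycleList r l ∧ l.length = Fintype.card V := by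
  by_contra hno
  push Not at hno
  obtain ⟨n, c, a, P, b, hn, hM, hO⟩ := exists_maxCyc_offPath hδ hirr hout hno
  have hlen := hO.length_le hM.cyc
  obtain ⟨k, hk⟩ : ∃ k, P.length = k + 1 :=
    ⟨P.length - 1, by have := List.length_pos_of_mem hO.walk.mem_left; omega⟩
  have ha := hin a
  have hb := hout b
  obtain ⟨hkn, s, hs, hgap⟩ := hO.exists_shift hM hk hirr (by omega) (by omega)
  have hM' := hM.shift s
  have hO' := hO.shift hM.cyc s
  have h1 := hO'.inN_card_le hM' hk hirr
  have h2 := hO'.outN_card_le hM' hk hirr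
  -- This yields `2 * (δ - k) + k ≤ n`, while the disjoint path leaves `n ≤ 2 * δ - k - 1`.
  have h3 := (hO'.idx_card hM' (k := k) ⟨hkn, hs, hgap⟩).1
  omega

end ArcDisjoint

/-! ### Longest cycles in critical digraphs: one missing vertex or a cut vertex. -/

namespace ArcDisjoint

variable {V : Type*} {r : V → V → Prop} {n k m : ℕ} {c : ℕ → V} {a b : V}
  {P : List V}

/-- The equalities forced by a longest cycle and a path off it in a critical digraph. -/
structure Tight (r : V → V → Prop) (m n k : ℕ) (c : ℕ → V) (a b : V) : Prop where
  len : n + k = 2 * m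
  cardIn : (inIdx r n c a).card + k = m
  of_not : ∀ i, 1 ≤ i → i ≤ n → ¬ (2 ≤ i ∧ i ≤ k + 1) → ¬ r (c (i - 1)) a → r b (c i)

/-- For a path with at least two vertices, the in-neighbours of its start and the out-neighbours
of its end form two segments of the cycle. -/
theorem OffPath.segments (hM : MaxCyc r n c) (h : OffPath r c a P b)
    (hk : P.length = k + 1) (hk1 : 1 ≤ k) (hs : GapStart r n k c a b)
    (ht : Tight r m n k c a b) (hkm : k < m) :
    (∀ i, m + 1 ≤ i → i ≤ n → r (c i) a) ∧ ∀ i, k + 2 ≤ i → i ≤ m + 1 → r b (c i) := by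
  classical
  have hl := ht.len
  have hA := ht.cardIn
  have cn : r (c n) a := by
    have := hM.cyc.per 0
    rw [Nat.zero_add] at this
    rw [this]; exact hs.zero
  -- If `c (i + 1)` were not an in-neighbour, tightness would give `b → c (i + 2)`, and a path of at
  -- least two vertices would replace the single vertex `c (i + 1)`.
  have up : ∀ i, k + 2 ≤ i → i < n → r (c i) a → r (c (i + 1)) a := by
    intro i h1 h2 h3
    by_contra h4
    rcases Nat.lt_or_ge (i + 1) n with h5 | h5
    · have h6 := ht.of_not (i + 2) (by omega) (by omega) (by omega) h4
      have := hM.detour (i := i) (d := 2) h.walk h.nodup h.off (by omega) (by omega) h3 h6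
      omega
    · rw [show i + 1 = n by omega] at h4
      exact h4 cn
  have up' : ∀ i j, k + 2 ≤ i → i ≤ j → j ≤ n → r (c i) a → r (c j) a := by
    intro i j h1 h2
    induction j, h2 using Nat.le_induction with
    | base => exact fun _ h => h
    | succ j hj ih => exact fun h3 h4 => up j (by omega) (by omega) (ih (by omega) h4)
  have hi : ∀ i, m + 1 ≤ i → i ≤ n → r (c i) a := by
    intro i h1 h2
    by_contra h3
    have hsub : inIdx r n c a ⊆ insert 0 (Finset.Ico (i + 1) n) := by
      intro j hj
      rw [mem_inIdx] at hj
      rw [Finset.mem_insert, Finset.mem_Ico]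
      by_contra h4
      rcases Nat.lt_or_ge j (k + 2) with h5 | h5
      · exact (hs.gap j (by omega) (by omega)).1 hj.2
      · exact h3 (up' j i h5 (by omega) h2 hj.2)
    have h4 := (Finset.card_le_card hsub).trans (Finset.card_insert_le _ _)
    rw [Nat.card_Ico] at h4
    have : i ≠ n := by rintro rfl; exact h3 cn
    omega
  refine ⟨hi, fun i h1 h2 => ?_⟩
  refine ht.of_not i (by omega) (by omega) (by omega) (fun h3 => ?_)
  rcases Nat.lt_or_ge (i - 1) (k + 2) with h5 | h5
  · exact (hs.gap (i - 1) (by omega) (by omega)).1 h3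
  · have hsub : insert 0 (Finset.Ico (i - 1) n) ⊆ inIdx r n c a := by
      intro j hj
      rw [Finset.mem_insert, Finset.mem_Ico] at hj
      rw [mem_inIdx]
      rcases hj with rfl | hj
      · exact ⟨by omega, hs.zero⟩
      · exact ⟨hj.2, up' (i - 1) j h5 hj.1 hj.2.le h3⟩
    have h4 := Finset.card_le_card hsub
    rw [Finset.card_insert_of_notMem (by rw [Finset.mem_Ico]; omega), Nat.card_Ico] at h4
    omega

variable [Fintype V]

/-- With `2 * m + 1` vertices the Ghouila-Houri count has no slack: both the upper and the lower
bound for `n` equal `2 * m - k`. -/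
theorem OffPath.tight (hc : Crit r m) (hM : MaxCyc r n c) (h : OffPath r c a P b)
    (hk : P.length = k + 1) (hs : GapStart r n k c a b) : Tight r m n k c a b := by
  have hlen := h.length_le hM.cyc
  rw [hc.card] at hlen
  have h1 := h.inN_card_le hM hk hc.irr
  have h2 := h.outN_card_le hM hk hc.irr
  obtain ⟨h3, h4⟩ := h.idx_card hM hs
  have ha := hc.inn a
  have hb := hc.out b
  exact ⟨by omega, by omega, h4 (by omega)⟩

theorem OffPath.cover (hc : Crit r m) (hM : MaxCyc r n c) (h : OffPath r c a P b)
    (hk : P.length = k + 1) (hl : n + k = 2 * m) (v : V) (hv : ∀ i, c i ≠ v) : v ∈ P := by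
  classical
  have hn : (seg c 0 n ++ P).Nodup := by
    rw [List.nodup_append]
    refine ⟨hM.cyc.seg_nodup 0 le_rfl, h.nodup, ?_⟩
    intro x hx y hy
    obtain ⟨j, -, rfl⟩ := mem_seg.1 hx
    exact h.off y hy _
  have huni : (seg c 0 n ++ P).toFinset = Finset.univ := by
    apply Finset.eq_univ_of_card
    rw [List.toFinset_card_of_nodup hn, List.length_append, seg_length, hk, hc.card]
    omega
  have hmem : v ∈ (seg c 0 n ++ P).toFinset := by rw [huni]; exact Finset.mem_univ _
  rw [List.mem_toFinset, List.mem_append] at hmem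
  rcases hmem with h1 | h1
  · obtain ⟨j, -, hj⟩ := mem_seg.1 h1
    exact absurd hj (hv _)
  · exact h1

theorem OffPath.adj_start (hc : Crit r m) (hM : MaxCyc r n c) (h : OffPath r c a P b)
    (hk : P.length = k + 1) (ht : Tight r m n k c a b) {v : V} (hv : v ∈ P) (hva : v ≠ a) :
    r v a := by
  classical
  by_contra hn
  have hsub : inN r a ⊆ (inIdx r n c a).image c ∪ (P.toFinset.erase a).erase v := by
    intro x hx
    rw [mem_inN] at hx
    rw [Finset.mem_union, Finset.mem_image, Finset.mem_erase, Finset.mem_erase,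
      List.mem_toFinset]
    by_cases hi : ∃ i, c i = x
    · obtain ⟨i, rfl⟩ := hi
      refine Or.inl ⟨i % n, mem_inIdx.2 ⟨Nat.mod_lt _ hM.cyc.pos, ?_⟩, hM.cyc.mod i⟩
      rwa [hM.cyc.mod]
    · push Not at hi
      refine Or.inr ⟨by rintro rfl; exact hn hx, by rintro rfl; exact hc.irr _ hx,
        h.inn x hi hx⟩
  have h1 := (Finset.card_le_card hsub).trans (Finset.card_union_le _ _)
  have h2 := Finset.card_image_le (s := inIdx r n c a) (f := c)
  have hv' : v ∈ P.toFinset.erase a := by simp [hv, hva]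
  have hpos := Finset.card_pos.2 ⟨v, hv'⟩
  rw [Finset.card_erase_of_mem hv'] at h1
  rw [Finset.card_erase_of_mem (List.mem_toFinset.2 h.walk.mem_left),
      List.toFinset_card_of_nodup h.nodup, hk] at h1 hpos
  have := hc.inn a
  have := ht.cardIn
  omega

/-- Exchanging the path for the segment of the cycle that it can replace. -/
theorem OffPath.exchange (hc : Crit r m) (hM : MaxCyc r n c) (h : OffPath r c a P b)
    (hk : P.length = k + 1) (hs : GapStart r n k c a b) (ht : Tight r m n k c a b)
    (hkm : k + 1 < m) (hb : r b (c (k + 2))) :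
    ∃ d, MaxCyc r n d ∧ OffPath r d (c 1) (seg c 1 (k + 1)) (c (k + 1)) ∧
      GapStart r n k d (c 1) (c (k + 1)) ∧ ∀ i, k + 2 ≤ i → i < n → d i = c i := by
  classical
  have hl := ht.len
  have C := hM.cyc
  set l := seg c 0 1 ++ (P ++ seg c (k + 2) (n - k - 2)) with hldef
  have hlen : l.length = n := by
    rw [hldef, List.length_append, List.length_append, seg_length, seg_length, hk]; omega
  have hperm : (l ++ seg c 1 (k + 1)).Perm (seg c 0 n ++ P) := by
    rw [seg_split c (k := 0) (n := n) (a := 1) (k' := 1) (b := n - 1) (by omega) (by omega),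
      seg_split c (k := 1) (n := n - 1) (a := k + 1) (k' := k + 2) (b := n - k - 2) (by omega)
        (by omega), List.perm_iff_count]
    intro x
    simp only [hldef, List.count_append]
    ring
  have hnd : (l ++ seg c 1 (k + 1)).Nodup := by
    rw [hperm.nodup_iff, List.nodup_append]
    refine ⟨C.seg_nodup 0 le_rfl, h.nodup, ?_⟩
    intro x hx y hy
    obtain ⟨j, -, rfl⟩ := mem_seg.1 hx
    exact h.off y hy _
  have hw : IsWalk r (c 0) l (c (n - 1)) := by
    rw [hldef, seg_one]
    exact (IsWalk.single _).append hs.zero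
      (h.walk.append hb (C.isWalk' (by omega) (by omega)))
  have hclose : r (c (n - 1)) (c 0) := by
    have := C.adj (n - 1)
    rwa [show n - 1 + 1 = 0 + n by omega, C.per] at this
  obtain ⟨hnl, -, hdisj⟩ := List.nodup_append.1 hnd
  obtain ⟨d, hd, hseg, hd0, -⟩ := Cyc.of_list hnl hw hclose
  rw [hlen] at hd hseg
  have hdM : MaxCyc r n d := ⟨hd, hM.max⟩
  have hdl : ∀ i, d i ∈ l := by
    intro i
    rw [← hseg, mem_seg]
    exact ⟨i % n, Nat.mod_lt _ hd.pos, by rw [Nat.zero_add, hd.mod]⟩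
  have hval : ∀ i, k + 2 ≤ i → i < n → d i = c i := by
    have h1 : seg d 0 1 ++ (seg d 1 (k + 1) ++ seg d (k + 2) (n - k - 2)) = l := by
      rw [← hseg, seg_split d (k := 0) (n := n) (a := 1) (k' := 1) (b := n - 1) (by omega)
        (by omega), seg_split d (k := 1) (n := n - 1) (a := k + 1) (k' := k + 2)
        (b := n - k - 2) (by omega) (by omega)]
    have h2 := (List.append_inj h1 (by simp [seg_length])).2
    have h3 := (List.append_inj h2 (by rw [seg_length, hk])).2
    intro i hi1 hi2
    have h4 : (seg d (k + 2) (n - k - 2))[i - (k + 2)]'(by rw [seg_length]; omega)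
        = (seg c (k + 2) (n - k - 2))[i - (k + 2)]'(by rw [seg_length]; omega) := by
      simp only [h3]
    rw [seg_getElem, seg_getElem, show k + 2 + (i - (k + 2)) = i by omega] at h4
    exact h4
  have hall : ∀ v, (∀ i, d i ≠ v) → v ∈ seg c 1 (k + 1) := by
    intro v hv
    have h1 : v ∈ l ++ seg c 1 (k + 1) := by
      rw [hperm.mem_iff, List.mem_append]
      by_cases hi : ∃ i, c i = v
      · obtain ⟨i, rfl⟩ := hi
        exact Or.inl (mem_seg.2 ⟨i % n, Nat.mod_lt _ C.pos, by rw [Nat.zero_add, C.mod]⟩)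
      · push Not at hi
        exact Or.inr (h.cover hc hM hk hl v hi)
    rcases List.mem_append.1 h1 with h2 | h2
    · rw [← hseg, mem_seg] at h2
      obtain ⟨j, -, hj⟩ := h2
      exact absurd hj (hv _)
    · exact h2
  have hO : OffPath r d (c 1) (seg c 1 (k + 1)) (c (k + 1)) := by
    refine ⟨C.isWalk' (by omega) (by omega), C.seg_nodup _ (by omega), ?_,
      fun v hv _ => hall v hv, fun v hv _ => hall v hv⟩
    intro v hv i hi
    exact hdisj (d i) (hdl i) v hv hi
  have h0 : r (d 0) (c 1) := by rw [hd0]; exact C.adj 0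
  have hk2 : r (c (k + 1)) (d (k + 2)) := by
    rw [hval (k + 2) le_rfl (by omega)]; exact C.adj _
  refine ⟨d, hdM, hO, ⟨hs.le, h0, fun j hj1 hj2 => ⟨fun h1 => ?_, fun h1 => ?_⟩⟩, hval⟩
  · have := hdM.detour (i := j) (d := k + 2 - j) hO.walk hO.nodup hO.off (by omega) (by omega) h1
      (by rwa [show j + (k + 2 - j) = k + 2 by omega])
    rw [seg_length] at this
    omega
  · have := hdM.detour (i := 0) (d := j) hO.walk hO.nodup hO.off (by omega) (by omega) h0
      (by rwa [Nat.zero_add])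
    rw [seg_length] at this
    omega

/-- The vertex `c (k + 2)` is shown to have out-neighbours only among `c (k + 3), …, c (m + 1)`,
fewer than `m`. The exchanged cycle supplies the arc `c (k + 1) → c (k + 3)` used for this. -/
theorem OffPath.not_medium (hc : Crit r m) (hM : MaxCyc r n c) (h : OffPath r c a P b)
    (hk : P.length = k + 1) (hk1 : 1 ≤ k) (hs : GapStart r n k c a b) (hkm : k + 1 < m) :
    False := by
  classical
  have ht := h.tight hc hM hk hs
  have hl := ht.len
  have C := hM.cyc
  obtain ⟨hS, hT⟩ := h.segments hM hk hk1 hs ht (by omega)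
  have hb2 := hT (k + 2) (by omega) (by omega)
  have hb3 := hT (k + 3) (by omega) (by omega)
  obtain ⟨d, hdM, hdO, hds, hval⟩ := h.exchange hc hM hk hs ht hkm hb2
  have hdt := hdO.tight hc hdM (seg_length _ _ _) hds
  have hR : r (c (k + 1)) (d (k + 3)) :=
    (hdO.segments hdM (seg_length _ _ _) hk1 hds hdt (by omega)).2 (k + 3) (by omega) (by omega)
  have hR' : r (c (k + 1)) (c (k + 3)) := by rwa [hval (k + 3) (by omega) (by omega)] at hR
  have hsub : outN r (c (k + 2)) ⊆ (Finset.Icc (k + 3) (m + 1)).image c := by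
    intro v hv
    rw [mem_outN] at hv
    rw [Finset.mem_image]
    by_cases hi : ∃ i, c i = v
    swap
    · exfalso
      push Not at hi
      have hvP := h.cover hc hM hk hl v hi
      obtain ⟨l₁, x, l₂, rfl, rfl, -⟩ := exists_first_of_mem (p := (· = v)) ⟨v, hvP, rfl⟩
      have := hM.detour (i := k + 2) (d := 1) h.walk.suffix (List.nodup_append.1 h.nodup).2.1
        (fun y hy => h.off y (List.mem_append_right _ hy)) le_rfl (by omega) hv hb3
      simp at this
    obtain ⟨i₀, rfl⟩ := hi
    obtain ⟨i, hin, hi⟩ := C.exists_add_eq 1 i₀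
    rw [← hi] at hv ⊢
    obtain ⟨i', hi'⟩ : ∃ j, j = 1 + i := ⟨_, rfl⟩
    rw [← hi'] at hv ⊢
    rcases Nat.lt_or_ge i' (k + 2) with h1 | h1
    -- An arc back into `c 1, …, c (k + 1)` would let the end of that segment be inserted between `c
    -- (k + 2)` and `c (k + 3)` in the exchanged cycle.
    · exfalso
      have hoff : ∀ y ∈ seg c i' (k + 2 - i'), ∀ j, d j ≠ y := by
        intro y hy
        refine hdO.off y ?_
        obtain ⟨j, hj, rfl⟩ := mem_seg.1 hy
        exact mem_seg.2 ⟨i' - 1 + j, by omega, by congr 1; omega⟩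
      have := hdM.detour (i := k + 2) (d := 1)
        (C.isWalk' (i := i') (j := k + 1) (k := k + 2 - i') (by omega) (by omega))
        (C.seg_nodup _ (by omega)) hoff le_rfl (by omega)
        (by rwa [hval (k + 2) le_rfl (by omega)]) hR
      rw [seg_length] at this
      omega
    rcases Nat.lt_or_ge i' (m + 2) with h2 | h2
    · refine ⟨i', Finset.mem_Icc.2 ⟨?_, by omega⟩, rfl⟩
      rcases h1.eq_or_lt with h3 | h3
      · rw [← h3] at hv; exact absurd hv (hc.irr _)
      · exact h3
    -- For `i' ≥ m + 2` the vertex `c (i' - 1)` is an in-neighbour of `a`, so a Hamiltonian cycle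
    -- runs `c (k + 2), c i', …, c n, c 1, …, c (k + 1), c (k + 3), …, c (i' - 1)`, then `P`.
    · exfalso
      have cn : r (c n) (c 1) := by
        have := C.adj n
        rwa [show n + 1 = 1 + n by omega, C.per] at this
      have hperm : ([c (k + 2)] ++ (seg c i' (n + 1 - i') ++ (seg c 1 (k + 1) ++
          (seg c (k + 3) (i' - k - 3) ++ P)))).Perm (seg c 1 n ++ P) := by
        rw [seg_split c (k := 1) (n := n) (a := k + 1) (k' := k + 2) (b := n - k - 1) (by omega)
            (by omega),
          seg_split c (k := k + 2) (n := n - k - 1) (a := 1) (k' := k + 3) (b := n - k - 2)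
            (by omega) (by omega),
          seg_split c (k := k + 3) (n := n - k - 2) (a := i' - k - 3) (k' := i')
            (b := n + 1 - i') (by omega) (by omega), seg_one, List.perm_iff_count]
        intro x
        simp only [List.count_append]
        ring
      refine hc.nonham _ ⟨hperm.nodup_iff.2 ?_, c (k + 2), b, ?_, hb2⟩ ?_
      · rw [List.nodup_append]
        refine ⟨C.seg_nodup 1 le_rfl, h.nodup, ?_⟩
        intro x hx y hy
        obtain ⟨j, -, rfl⟩ := mem_seg.1 hx
        exact h.off y hy _
      · exact (IsWalk.single _).append hv <|
          (C.isWalk' (j := n) (by omega) (by omega)).append cn <|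
          (C.isWalk' (j := k + 1) (by omega) (by omega)).append hR' <|
          (C.isWalk' (j := i' - 1) (by omega) (by omega)).append
            (hS (i' - 1) (by omega) (by omega)) h.walk
      · rw [hperm.length_eq, List.length_append, seg_length, hk]; omega
  have h1 := (Finset.card_le_card hsub).trans Finset.card_image_le
  rw [Nat.card_Icc] at h1
  have := hc.out (c (k + 2))
  omega

/-- A longest cycle with `m + 1` vertices meets the neighbourhoods of a path off it in a single
vertex. -/
theorem OffPath.exists_contact (hc : Crit r m) (hM : MaxCyc r (m + 1) c) (h : OffPath r c a P b)
    (hk : P.length = m) (hm : 0 < m) :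
    ∃ s, r (c s) a ∧ r b (c s) ∧ ∀ i, (r (c i) a → c i = c s) ∧ (r b (c i) → c i = c s) := by
  classical
  obtain ⟨k, rfl⟩ : ∃ k, m = k + 1 := ⟨m - 1, by omega⟩
  have hin := hc.inn a
  have hout := hc.out b
  obtain ⟨hle, s, hs, hgap⟩ := h.exists_shift hM hk hc.irr (by omega) (by omega)
  have hM' := hM.shift s
  have h' := h.shift hM.cyc s
  have hG : GapStart r (k + 1 + 1) k (fun i => c (s + i)) a b := ⟨hle, hs, hgap⟩
  have ht := h'.tight hc hM' hk hG
  have hb : r b (c (s + (k + 2))) :=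
    ht.of_not (k + 2) (by omega) (by omega) (by omega) (hgap (k + 1) (by omega) (by omega)).1
  have e : c (s + (k + 2)) = c s := hM.cyc.per s
  rw [e] at hb
  refine ⟨s, hs, hb, fun i => ?_⟩
  obtain ⟨j, hj, e⟩ := hM.cyc.exists_add_eq s i
  rw [← e]
  rcases Nat.eq_zero_or_pos j with rfl | h0
  · simp
  · exact ⟨fun h1 => absurd h1 (hgap j h0 (by omega)).1,
      fun h1 => absurd h1 (hgap j h0 (by omega)).2⟩

/-- `X` and `Y` are separated by the vertex `z`. -/
structure CutVertex (r : V → V → Prop) (m : ℕ) (z : V) (X Y : Finset V) : Prop where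
  cardX : X.card = m
  cardY : Y.card = m
  disj : Disjoint X Y
  notX : z ∉ X
  notY : z ∉ Y
  noXY : ∀ x ∈ X, ∀ y ∈ Y, ¬ r x y ∧ ¬ r y x

/-- The path closes to a cycle, so each of its rotations is again a path off `c` and touches `c` in
a single vertex. That vertex is the same for all rotations and separates the two cycles. -/
theorem OffPath.exists_cutVertex (hc : Crit r m) (hM : MaxCyc r (m + 1) c)
    (h : OffPath r c a P b) (hk : P.length = m) (hm : 2 ≤ m) (hba : r b a) :
    ∃ z X Y, CutVertex r m z X Y := by
  classical
  obtain ⟨p, hp, hseg, -, -⟩ := Cyc.of_list h.nodup h.walk hba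
  rw [hk] at hp hseg
  have pmem : ∀ i, p i ∈ P := by
    intro i
    rw [← hseg, mem_seg]
    exact ⟨i % m, Nat.mod_lt _ hp.pos, by rw [Nat.zero_add, hp.mod]⟩
  have hcov := h.cover hc hM (k := m - 1) (by omega) (by omega)
  have hsegP : ∀ i v, v ∈ P → v ∈ seg p i m := by
    intro i v hv
    rw [← hseg, mem_seg] at hv
    obtain ⟨j, hj, rfl⟩ := hv
    exact mem_seg.2 (hp.exists_add_eq i _)
  have hoff : ∀ v ∈ P, ∀ i, c i ≠ v := h.off
  have hrot : ∀ i, OffPath r c (p i) (seg p i m) (p (i + m - 1)) := by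
    intro i
    refine ⟨hp.isWalk' (by omega) (by omega), hp.seg_nodup i le_rfl, ?_,
      fun v hv _ => hsegP i v (hcov v hv), fun v hv _ => hsegP i v (hcov v hv)⟩
    intro v hv
    obtain ⟨j, -, rfl⟩ := mem_seg.1 hv
    exact hoff _ (pmem _)
  have hcon := fun i => (hrot i).exists_contact hc hM (seg_length _ _ _) (by omega)
  choose z hz1 hz2 hz3 using hcon
  have hz2' : ∀ i, r (p i) (c (z (i + 1))) := by
    intro i
    have := hz2 (i + 1)
    rwa [show i + 1 + m - 1 = i + m by omega, hp.per] at this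
  -- If the contacts differed at distance `d`, the single vertex `p i` would be a detour from the
  -- first to the second, forcing `d ≥ 2`, and the other `m - 1` path vertices one back, forcing `d
  -- ≤ 1`.
  have hstep : ∀ i, c (z (i + 1)) = c (z i) := by
    intro i
    by_contra hne
    have hd : ∃ d, 1 ≤ d ∧ d < m + 1 ∧ c (z i + d) = c (z (i + 1)) := by
      obtain ⟨d, hd, e⟩ := hM.cyc.exists_add_eq (z i) (z (i + 1))
      refine ⟨d, ?_, hd, e⟩
      by_contra h0
      rw [Nat.not_le, Nat.lt_one_iff] at h0
      rw [h0, Nat.add_zero] at e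
      exact hne e.symm
    obtain ⟨d, hd1, hd2, hd3⟩ := hd
    have h1 := hM.detour (i := z i) (d := d) (IsWalk.single (p i)) (by simp)
      (by intro v hv; rw [List.mem_singleton] at hv; subst hv; exact hoff _ (pmem _))
      hd1 (by omega) (hz1 i) (by rw [hd3]; exact hz2' i)
    have h2 := hM.detour (i := z i + d) (d := m + 1 - d)
      (hp.isWalk' (i := i + 1) (j := i + m - 1) (k := m - 1) (by omega) (by omega))
      (hp.seg_nodup _ (by omega))
      (by intro v hv; obtain ⟨j, -, rfl⟩ := mem_seg.1 hv; exact hoff _ (pmem _))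
      (by omega) (by omega) (by rw [hd3]; exact hz1 (i + 1))
      (by
        rw [show z i + d + (m + 1 - d) = z i + (m + 1) by omega, hM.cyc.per]
        exact hz2 i)
    rw [seg_length] at h2
    simp only [List.length_singleton] at h1
    omega
  have hconst : ∀ i, c (z i) = c (z 0) := by
    intro i
    induction i with
    | zero => rfl
    | succ i ih => rw [hstep, ih]
  have hPp : ∀ v ∈ P, ∃ i, p i = v := by
    intro v hv
    rw [← hseg, mem_seg] at hv
    obtain ⟨j, -, hj⟩ := hv
    exact ⟨_, hj⟩
  refine ⟨c (z 0), P.toFinset, (seg c 0 (m + 1)).toFinset.erase (c (z 0)), ?_, ?_, ?_, ?_, ?_, ?_⟩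
  · rw [List.toFinset_card_of_nodup h.nodup, hk]
  · rw [Finset.card_erase_of_mem, List.toFinset_card_of_nodup (hM.cyc.seg_nodup 0 le_rfl),
      seg_length]
    · rfl
    · rw [List.mem_toFinset, mem_seg]
      exact ⟨z 0 % (m + 1), Nat.mod_lt _ (by omega), by rw [Nat.zero_add, hM.cyc.mod]⟩
  · rw [Finset.disjoint_left]
    intro v hv hv'
    rw [List.mem_toFinset] at hv
    rw [Finset.mem_erase, List.mem_toFinset, mem_seg] at hv'
    obtain ⟨-, j, -, hj⟩ := hv'
    exact hoff v hv _ hj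
  · rw [List.mem_toFinset]
    intro hv
    exact hoff _ hv _ rfl
  · simp
  · intro x hx y hy
    rw [List.mem_toFinset] at hx
    rw [Finset.mem_erase, List.mem_toFinset, mem_seg] at hy
    obtain ⟨i, rfl⟩ := hPp x hx
    obtain ⟨hne, j, -, rfl⟩ := hy
    constructor
    · intro h1
      apply hne
      rw [← hconst (i + 1)]
      refine (hz3 (i + 1) _).2 ?_
      rwa [show i + 1 + m - 1 = i + m by omega, hp.per]
    · intro h1
      apply hne
      rw [← hconst i]
      exact (hz3 i _).1 h1

/-- A critical digraph has a cycle missing a single vertex, or a cut vertex. -/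
theorem Crit.mis_or_cutVertex (hc : Crit r m) (hm : 0 < m) :
    (∃ u c, Mis r m u c) ∨ ∃ z X Y, CutVertex r m z X Y := by
  have : Nonempty V := Fintype.card_pos_iff.1 (by rw [hc.card]; omega)
  obtain ⟨n, c, a, P, b, hn, hM, hO⟩ := exists_maxCyc_offPath hm hc.irr hc.out
    (by rw [hc.card]; exact hc.nonham)
  have hlen := hO.length_le hM.cyc
  rw [hc.card] at hlen
  obtain ⟨k, hk⟩ : ∃ k, P.length = k + 1 :=
    ⟨P.length - 1, by have := List.length_pos_of_mem hO.walk.mem_left; omega⟩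
  have ha := hc.inn a
  have hb := hc.out b
  obtain ⟨hkn, s, hs, hgap⟩ := hO.exists_shift hM hk hc.irr (by omega) (by omega)
  have hM' := hM.shift s
  have hO' := hO.shift hM.cyc s
  have hG : GapStart r n k (fun i => c (s + i)) a b := ⟨hkn, hs, hgap⟩
  have ht := hO'.tight hc hM' hk hG
  have hl := ht.len
  rcases Nat.eq_zero_or_pos k with rfl | hk1
  · left
    obtain rfl : n = 2 * m := by omega
    exact ⟨a, c, hM.cyc, fun i => hO.off a hO.walk.mem_left i⟩
  -- Since the cycle has at least `m + 1` vertices, `k ≤ m - 1`, and only `k = m - 1` remains beside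
  -- the excluded range.
  rcases Nat.lt_or_ge (k + 1) m with hkm | hkm
  · exact (hO'.not_medium hc hM' hk hk1 hG hkm).elim
  · right
    obtain rfl : n = m + 1 := by omega
    refine hO.exists_cutVertex hc hM (by omega) (by omega) ?_
    refine hO'.adj_start hc hM' hk ht hO.walk.mem_right ?_
    rintro rfl
    have h1 := hO.walk.2.1
    have h2 := hO.walk.2.2
    have hne : P ≠ [] := by rintro rfl; simp at hk
    rw [List.head?_eq_getElem?, List.getElem?_eq_getElem (by omega)] at h1
    rw [List.getLast?_eq_getElem?, List.getElem?_eq_getElem (by omega)] at h2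
    have := (hO.nodup.getElem_inj_iff).1 ((Option.some.inj h1).trans (Option.some.inj h2).symm)
    omega

end ArcDisjoint

/-! ### Finite verifications on five and seven labels. -/

namespace ArcDisjoint

section Finite

theorem ofNat_succ (n : ℕ) [NeZero n] (i : ℕ) : Fin.ofNat n (i + 1) = Fin.ofNat n i + 1 := by
  apply Fin.ext
  simp [Fin.val_add, Fin.ofNat]

theorem ofNat_add_self (n : ℕ) [NeZero n] (i : ℕ) : Fin.ofNat n (i + n) = Fin.ofNat n i := by
  apply Fin.ext
  simp [Fin.ofNat]

/-- No Hamiltonian cycle avoids the arcs `fiveArcs`. -/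
theorem five_check : ∀ a₁ ∉ fiveArcs 0, ∀ a₂ ∉ fiveArcs a₁, ∀ a₃ ∉ fiveArcs a₂,
    ∀ a₄ ∉ fiveArcs a₃, 0 ∉ fiveArcs a₄ → ¬ [0, a₁, a₂, a₃, a₄].Nodup := by
  decide +kernel

/-- The closed walks `p` and `q` are arc-disjoint Hamiltonian cycles of the union of `sevenArcs`
and the closed walk `t`. -/
def IsSevenPair (t p q : Fin 7 → Fin 7) : Prop :=
  (∀ i j, p i = p j → i = j) ∧ (∀ i j, q i = q j → i = j) ∧
  (∀ j, p (j + 1) ∈ sevenArcs (p j) ∨ ∃ i, t i = p j ∧ t (i + 1) = p (j + 1)) ∧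
  (∀ j, q (j + 1) ∈ sevenArcs (q j) ∨ ∃ i, t i = q j ∧ t (i + 1) = q (j + 1)) ∧
  ∀ i j, p i = q j → p (i + 1) ≠ q (j + 1)

instance (t p q : Fin 7 → Fin 7) : Decidable (IsSevenPair t p q) := by
  unfold IsSevenPair; infer_instance

/-- Pairs of arc-disjoint Hamiltonian cycles. -/
def sevenPairs : List ((Fin 7 → Fin 7) × (Fin 7 → Fin 7)) :=
  [(![0, 1, 2, 3, 4, 6, 5], ![0, 2, 5, 1, 6, 4, 3]),
   (![0, 1, 2, 3, 4, 6, 5], ![0, 2, 1, 5, 6, 4, 3]),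
   (![0, 1, 2, 3, 4, 6, 5], ![0, 2, 6, 1, 4, 5, 3]),
   (![0, 1, 2, 3, 6, 4, 5], ![0, 2, 6, 1, 5, 4, 3]),
   (![0, 1, 2, 3, 4, 5, 6], ![0, 2, 1, 3, 6, 5, 4]),
   (![0, 1, 2, 3, 5, 6, 4], ![0, 2, 1, 6, 3, 4, 5])]

/-- Some pair of `sevenPairs` lies in the union of `sevenArcs` and the closed walk `t`. -/
def HasSevenPair (t : Fin 7 → Fin 7) : Prop := ∃ x ∈ sevenPairs, IsSevenPair t x.1 x.2

instance (t : Fin 7 → Fin 7) : Decidable (HasSevenPair t) := by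
  unfold HasSevenPair; infer_instance

-- The closed walk `t` plays the deleted cycle, whose arcs are available again for the new pair. It
-- is enumerated vertex by vertex from `0`, with distinctness tested early to prune the search; six
-- pairs serve all cases.
set_option synthInstance.maxHeartbeats 400000 in
set_option synthInstance.maxSize 1024 in
theorem seven_check : ∀ a₁ ∉ sevenArcs 0, ∀ a₂ ∉ sevenArcs a₁, ∀ a₃ ∉ sevenArcs a₂,
    ∀ a₄ ∉ sevenArcs a₃, [0, a₁, a₂, a₃, a₄].Nodup → ∀ a₅ ∉ sevenArcs a₄, ∀ a₆ ∉ sevenArcs a₅,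
    0 ∉ sevenArcs a₆ → [0, a₁, a₂, a₃, a₄, a₅, a₆].Nodup →
    HasSevenPair ![0, a₁, a₂, a₃, a₄, a₅, a₆] := by
  decide +kernel

theorem seven_pair {t : Fin 7 → Fin 7} (ht : Function.Injective t) (h0 : t 0 = 0)
    (h : ∀ j, t (j + 1) ∉ sevenArcs (t j)) : ∃ p q, IsSevenPair t p q := by
  have e : t = ![0, t 1, t 2, t 3, t 4, t 5, t 6] := by
    funext j; fin_cases j <;> simp [h0]
  have hn : [t 0, t 1, t 2, t 3, t 4, t 5, t 6].Nodup := by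
    have := List.nodup_ofFn.2 ht
    simpa [List.ofFn_succ] using this
  rw [h0] at hn
  have h1 := h 0
  have h7 := h 6
  rw [h0] at h1
  have e7 : t (6 + 1) = 0 := h0
  rw [e7] at h7
  obtain ⟨x, -, hx⟩ := seven_check _ h1 _ (h 1) _ (h 2) _ (h 3)
    (hn.sublist (by simp)) _ (h 4) _ (h 5) h7 hn
  exact ⟨x.1, x.2, by rw [e]; exact hx⟩

end Finite

/-! ### Deleting a Hamiltonian cycle and assembling the proof. -/

variable {V : Type*} {r : V → V → Prop}

theorem Cyc.of_fin {n : ℕ} [NeZero n] {f : Fin n → V} (hf : Function.Injective f)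
    {p : Fin n → Fin n} (hp : ∀ i j, p i = p j → i = j) (h : ∀ j, r (f (p j)) (f (p (j + 1)))) :
    Cyc r n fun i => f (p (Fin.ofNat n i)) where
  pos := Nat.pos_of_ne_zero (NeZero.ne n)
  per i := by rw [ofNat_add_self]
  inj i hi j hj hij := by
    have := congrArg Fin.val (hp _ _ (hf hij))
    simpa [Fin.ofNat, Nat.mod_eq_of_lt hi, Nat.mod_eq_of_lt hj] using this
  adj i := by rw [ofNat_succ]; exact h _

/-- The digraph `r` without the arcs of the cycle `c`. -/
def removeCyc (r : V → V → Prop) (c : ℕ → V) (x y : V) : Prop :=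
  r x y ∧ ∀ i, c i = x → c (i + 1) ≠ y

theorem removeCyc_or {c : ℕ → V} {x y : V} (h : r x y) :
    removeCyc r c x y ∨ ∃ i, c i = x ∧ c (i + 1) = y := by
  by_cases hi : ∃ i, c i = x ∧ c (i + 1) = y
  · exact Or.inr hi
  · push Not at hi
    exact Or.inl ⟨h, hi⟩

theorem CutVertex.symm {m : ℕ} {z : V} {X Y : Finset V} (h : CutVertex r m z X Y) :
    CutVertex r m z Y X :=
  ⟨h.cardY, h.cardX, h.disj.symm, h.notY, h.notX, fun y hy x hx => (h.noXY x hx y hy).symm⟩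

variable [Fintype V] {c : ℕ → V} {m : ℕ}

theorem Cyc.surj (hc : Cyc r (Fintype.card V) c) (v : V) : ∃ i < Fintype.card V, c i = v := by
  classical
  have hn := hc.seg_nodup 0 le_rfl
  have h1 : (seg c 0 (Fintype.card V)).toFinset = Finset.univ := by
    apply Finset.eq_univ_of_card
    rw [List.toFinset_card_of_nodup hn, seg_length]
  have h2 : v ∈ (seg c 0 (Fintype.card V)).toFinset := by rw [h1]; exact Finset.mem_univ _
  rw [List.mem_toFinset, mem_seg] at h2
  simpa using h2

/-- A Hamiltonian cycle leaves every nonempty proper set of vertices. -/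
theorem Cyc.mem_of_closed (hc : Cyc r (Fintype.card V) c) {X : Set V} {x : V} (hx : x ∈ X)
    (h : ∀ i, c i ∈ X → c (i + 1) ∈ X) (v : V) : v ∈ X := by
  obtain ⟨i, -, rfl⟩ := hc.surj x
  obtain ⟨j, -, rfl⟩ := hc.surj v
  obtain ⟨k, -, hk⟩ := hc.exists_add_eq i j
  rw [← hk]
  clear hk
  induction k with
  | zero => exact hx
  | succ k ih => exact h _ ih

theorem card_outN_le (hc : Cyc r (Fintype.card V) c) (x : V) :
    (outN r x).card ≤ (outN (removeCyc r c) x).card + 1 := by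
  classical
  obtain ⟨i, -, rfl⟩ := hc.surj x
  have hsub : outN r (c i) ⊆ insert (c (i + 1)) (outN (removeCyc r c) (c i)) := by
    intro y hy
    rw [mem_outN] at hy
    rw [Finset.mem_insert, mem_outN]
    rcases removeCyc_or (c := c) hy with h | ⟨j, hj, rfl⟩
    · exact Or.inr h
    · left
      rw [hc.eq_iff] at hj ⊢
      exact Nat.ModEq.add_right 1 hj
  exact (Finset.card_le_card hsub).trans (Finset.card_insert_le _ _)

theorem card_inN_le (hc : Cyc r (Fintype.card V) c) (x : V) :
    (inN r x).card ≤ (inN (removeCyc r c) x).card + 1 := by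
  classical
  obtain ⟨i, -, hi⟩ := hc.surj x
  obtain ⟨k, -, hk⟩ := hc.exists_add_eq 1 i
  rw [← hk] at hi
  subst hi
  have hsub : inN r (c (1 + k)) ⊆ insert (c k) (inN (removeCyc r c) (c (1 + k))) := by
    intro y hy
    rw [mem_inN] at hy
    rw [Finset.mem_insert, mem_inN]
    rcases removeCyc_or (c := c) hy with h | ⟨j, rfl, hj⟩
    · exact Or.inr h
    · left
      rw [hc.eq_iff] at hj ⊢
      rw [Nat.add_comm 1 k] at hj
      exact Nat.ModEq.add_right_cancel' 1 hj
  exact (Finset.card_le_card hsub).trans (Finset.card_insert_le _ _)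

/-- Two arc-disjoint Hamiltonian cycles. -/
def HasPair (r : V → V → Prop) : Prop :=
  ∃ c d, Cyc r (Fintype.card V) c ∧ Cyc r (Fintype.card V) d ∧
    ∀ i j, c i = d j → c (i + 1) ≠ d (j + 1)

theorem hasPair_of_cycleList (hc : Cyc r (Fintype.card V) c) {l : List V}
    (hl : IsCycleList (removeCyc r c) l) (hlen : l.length = Fintype.card V) : HasPair r := by
  obtain ⟨hn, a, b, hw, hba⟩ := hl
  obtain ⟨d, hd, -⟩ := Cyc.of_list hn hw hba
  rw [hlen] at hd
  exact ⟨c, d, hc, ⟨hd.pos, hd.per, hd.inj, fun i => (hd.adj i).1⟩,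
    fun i j hij => (hd.adj j).2 i hij⟩

theorem CutVertex.exists_adj {z : V} {X Y : Finset V} {r' : V → V → Prop}
    (h : CutVertex r' m z X Y) (hcard : Fintype.card V = 2 * m + 1) (hirr : ∀ v, ¬ r v v)
    {x : V} (hx : x ∈ X) (hout : m + 1 ≤ (outN r x).card) : ∃ y ∈ Y, r x y := by
  classical
  by_contra hno
  push Not at hno
  have huni : insert z (X ∪ Y) = Finset.univ := by
    apply Finset.eq_univ_of_card
    rw [Finset.card_insert_of_notMem (by simp [h.notX, h.notY]),
      Finset.card_union_of_disjoint h.disj, h.cardX, h.cardY, hcard]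
    omega
  have hsub : outN r x ⊆ insert z (X.erase x) := by
    intro y hy
    rw [mem_outN] at hy
    have hy' : y ∈ insert z (X ∪ Y) := by rw [huni]; exact Finset.mem_univ _
    simp only [Finset.mem_insert, Finset.mem_union, Finset.mem_erase] at hy' ⊢
    rcases hy' with h1 | h1 | h1
    · exact Or.inl h1
    · exact Or.inr ⟨by rintro rfl; exact hirr _ hy, h1⟩
    · exact absurd hy (hno y h1)
  have h1 := (Finset.card_le_card hsub).trans (Finset.card_insert_le _ _)
  rw [Finset.card_erase_of_mem hx, h.cardX] at h1
  have := Finset.card_pos.2 ⟨x, hx⟩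
  rw [h.cardX] at this
  omega

/-- A vertex of `X` has at most `m` out-neighbours in `X ∪ {z}`, so in `r` it has one in `Y`, and
that arc must be the deleted one. By symmetry the deleted cycle alternates between `X` and `Y` and
never meets `z`. -/
theorem not_cutVertex (hc : Cyc r (Fintype.card V) c) (hm : 0 < m)
    (hcard : Fintype.card V = 2 * m + 1) (hirr : ∀ v, ¬ r v v)
    (hout : ∀ v, m + 1 ≤ (outN r v).card) {z : V} {X Y : Finset V}
    (h : CutVertex (removeCyc r c) m z X Y) : False := by
  classical
  have step : ∀ {X Y : Finset V}, CutVertex (removeCyc r c) m z X Y → ∀ i, c i ∈ X →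
      c (i + 1) ∈ Y := by
    intro X Y h i hi
    obtain ⟨y, hy, hadj⟩ := h.exists_adj hcard hirr hi (hout _)
    rcases removeCyc_or (c := c) hadj with h1 | ⟨j, hj, rfl⟩
    · exact absurd h1 (h.noXY _ hi _ hy).1
    · have e : c (i + 1) = c (j + 1) := by
        rw [hc.eq_iff] at hj ⊢
        exact (Nat.ModEq.add_right 1 hj).symm
      rwa [e]
  obtain ⟨x, hx⟩ := Finset.card_pos.1 (show 0 < X.card by rw [h.cardX]; exact hm)
  have := hc.mem_of_closed (X := {v | v ∈ X ∨ v ∈ Y}) (Or.inl hx)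
    (fun i hi => hi.elim (fun h1 => Or.inr (step h i h1)) (fun h1 => Or.inl (step h.symm i h1))) z
  exact this.elim h.notX h.notY

/-- The complement of `I` has only `m` vertices, so each vertex of `I` has an `r`-out-neighbour in
`I`, necessarily its successor on the deleted cycle. That cycle would never leave `I`. -/
theorem not_independent (hc : Cyc r (Fintype.card V) c) (hm : 0 < m)
    (hcard : Fintype.card V = 2 * m + 1) (hout : ∀ v, m + 1 ≤ (outN r v).card) {I : Finset V}
    (hI : I.card = m + 1) (h : ∀ x ∈ I, ∀ y ∈ I, ¬ removeCyc r c x y) : False := by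
  classical
  have step : ∀ i, c i ∈ I → c (i + 1) ∈ I := by
    intro i hi
    have hex : ∃ y ∈ I, r (c i) y := by
      by_contra hno
      push Not at hno
      have hsub : outN r (c i) ⊆ Iᶜ := by
        intro y hy
        rw [mem_outN] at hy
        rw [Finset.mem_compl]
        exact fun h1 => hno y h1 hy
      have h1 := Finset.card_le_card hsub
      rw [Finset.card_compl, hI, hcard] at h1
      have := hout (c i)
      omega
    obtain ⟨y, hy, hadj⟩ := hex
    rcases removeCyc_or (c := c) hadj with h1 | ⟨j, hj, rfl⟩
    · exact absurd h1 (h _ hi _ hy)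
    · have e : c (i + 1) = c (j + 1) := by
        rw [hc.eq_iff] at hj ⊢
        exact (Nat.ModEq.add_right 1 hj).symm
      rwa [e]
  obtain ⟨x, hx⟩ := Finset.card_pos.1 (show 0 < I.card by omega)
  have : I = Finset.univ := by
    rw [Finset.eq_univ_iff_forall]
    exact hc.mem_of_closed (X := {v | v ∈ I}) hx step
  rw [this, Finset.card_univ, hcard] at hI
  omega

/-- A Hamiltonian cycle, read off in the labels given by a bijection. -/
theorem exists_labels {n : ℕ} [NeZero n] (hcard : Fintype.card V = n) (hc : Cyc r n c)
    {f : Fin n → V} (hf : Function.Injective f) {A : Fin n → List (Fin n)}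
    (hA : ∀ i, ∀ j ∈ A i, removeCyc r c (f i) (f j)) :
    ∃ (s : ℕ) (t : Fin n → Fin n), Function.Injective t ∧ t 0 = 0 ∧
      (∀ j, t (j + 1) ∉ A (t j)) ∧ ∀ i, f (t (Fin.ofNat n i)) = c (s + i) := by
  subst hcard
  have hb : Function.Bijective f :=
    (Fintype.bijective_iff_injective_and_card f).2 ⟨hf, by simp⟩
  obtain ⟨s, -, hs⟩ := hc.surj (f 0)
  choose g hg using hb.2
  have hgf : ∀ x, g (f x) = x := fun x => hf (hg _)
  have hval : ∀ i, f (g (c (s + (Fin.ofNat (Fintype.card V) i : ℕ)))) = c (s + i) := by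
    intro i
    rw [hg, hc.eq_iff]
    simp [Fin.ofNat]
  refine ⟨s, fun j => g (c (s + j)), ?_, ?_, ?_, hval⟩
  · intro i j hij
    have h1 : c (s + i) = c (s + j) := by
      rw [← hg (c (s + i)), ← hg (c (s + j))]
      exact congrArg f hij
    exact Fin.ext ((hc.shift s).inj _ i.2 _ j.2 h1)
  · simp [hs, hgf]
  · intro j hj
    have h1 := hA _ _ hj
    have h2 : f (g (c (s + (j + 1 : Fin _)))) = c (s + j + 1) := by
      have := hval (j + 1)
      rw [ofNat_succ] at this
      have e : Fin.ofNat (Fintype.card V) (j : ℕ) = j := Fin.ext (Nat.mod_eq_of_lt j.2)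
      rw [e] at this
      exact this
    simp only [h2, hg] at h1
    exact h1.2 _ rfl rfl

theorem hasPair_odd (hc : Cyc r (Fintype.card V) c) (hm : 0 < m)
    (hcard : Fintype.card V = 2 * m + 1) (hirr : ∀ v, ¬ r v v)
    (hout : ∀ v, m + 1 ≤ (outN r v).card) (hin : ∀ v, m + 1 ≤ (inN r v).card) : HasPair r := by
  by_contra hno
  have hC : Crit (removeCyc r c) m := by
    refine ⟨hcard, fun v hv => hirr v hv.1, fun v => ?_, fun v => ?_, fun l hl hlen => ?_⟩
    · have := card_outN_le hc v
      have := hout v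
      omega
    · have := card_inN_le hc v
      have := hin v
      omega
    · exact hno (hasPair_of_cycleList hc hl (by rw [hlen, hcard]))
  rcases hC.mis_or_cutVertex hm with ⟨u, d, hd⟩ | ⟨z, X, Y, h⟩
  swap
  · exact not_cutVertex hc hm hcard hirr hout h
  by_cases hlong : ∃ u d, LongGap (removeCyc r c) m u d
  swap
  · push Not at hlong
    obtain ⟨I, hI, hI'⟩ := hd.exists_independent hlong hC
    exact not_independent hc hm hcard hout hI hI'
  obtain ⟨u, d, h⟩ := hlong
  have h2 := h.two_le
  rcases Nat.lt_or_ge m 4 with h4 | h4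
  swap
  · exact h.lt_four h4 hC
  obtain rfl | rfl : m = 2 ∨ m = 3 := by omega
  · obtain ⟨f, hf, hA⟩ := h.exists_five hC
    have hcard' : Fintype.card V = 5 := hcard
    rw [hcard'] at hc
    obtain ⟨s, t, ht, t0, tA, -⟩ := exists_labels hcard' hc hf hA
    have h0 := tA 0
    have h4 := tA 4
    rw [t0] at h0
    have e : t (4 + 1) = 0 := t0
    rw [e] at h4
    refine five_check _ h0 _ (tA 1) _ (tA 2) _ (tA 3) h4 ?_
    have hn : [t 0, t 1, t 2, t 3, t 4].Nodup := by
      have := List.nodup_ofFn.2 ht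
      simpa [List.ofFn_succ] using this
    rw [t0] at hn
    exact hn
  · obtain ⟨f, hf, hA⟩ := h.exists_seven hC
    have hcard' : Fintype.card V = 7 := hcard
    rw [hcard'] at hc
    obtain ⟨s, t, ht, t0, tA, tv⟩ := exists_labels hcard' hc hf hA
    obtain ⟨p, q, hp, hq, hp', hq', hpq⟩ := seven_pair ht t0 tA
    -- Both the forced arcs and the arcs of the deleted cycle belong to the original digraph `r`.
    have harc : ∀ x y : Fin 7, (y ∈ sevenArcs x ∨ ∃ i, t i = x ∧ t (i + 1) = y) →
        r (f x) (f y) := by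
      rintro x y (h1 | ⟨i, rfl, rfl⟩)
      · exact (hA x y h1).1
      · have e : Fin.ofNat 7 (i : ℕ) = i := Fin.ext (Nat.mod_eq_of_lt i.2)
        have h1 := tv i
        have h2 := tv (i + 1)
        rw [ofNat_succ] at h2
        rw [e] at h1 h2
        rw [h1, h2]
        exact hc.adj _
    apply hno
    refine ⟨fun i => f (p (Fin.ofNat 7 i)), fun i => f (q (Fin.ofNat 7 i)), ?_, ?_, ?_⟩
    · rw [hcard']
      exact Cyc.of_fin hf hp fun j => harc _ _ (hp' j)
    · rw [hcard']
      exact Cyc.of_fin hf hq fun j => harc _ _ (hq' j)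
    · intro i j hij hij'
      simp only [ofNat_succ] at hij'
      exact hpq _ _ (hf hij) (hf hij')

theorem hasPair (hirr : ∀ v, ¬ r v v) (hcard : 2 < Fintype.card V)
    (hout : ∀ v, Fintype.card V < 2 * (outN r v).card)
    (hin : ∀ v, Fintype.card V < 2 * (inN r v).card) : HasPair r := by
  have hne : Nonempty V := Fintype.card_pos_iff.1 (by omega)
  -- The least integer exceeding half the order is `(Fintype.card V + 2) / 2`, for either parity.
  obtain ⟨l, ⟨hn, a, b, hw, hba⟩, hlen⟩ := exists_hamiltonian
    (δ := (Fintype.card V + 2) / 2) (by omega) hirr (fun v => by have := hout v; omega)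
    (fun v => by have := hin v; omega) (by omega)
  obtain ⟨c, hc, -⟩ := Cyc.of_list hn hw hba
  rw [hlen] at hc
  obtain ⟨m, hm⟩ := Nat.even_or_odd' (Fintype.card V)
  rcases hm with hm | hm
  · obtain ⟨l', hl', hlen'⟩ := exists_hamiltonian (r := removeCyc r c) (δ := m) (by omega)
      (fun v hv => hirr v hv.1)
      (fun v => by have := hout v; have := card_outN_le hc v; omega)
      (fun v => by have := hin v; have := card_inN_le hc v; omega) (by omega)
    exact hasPair_of_cycleList hc hl' hlen'
  · exact hasPair_odd hc (m := m) (by omega) hm hirr (fun v => by have := hout v; omega)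
      (fun v => by have := hin v; omega)

theorem isHamiltonianCycle_of_cyc {D : Digraph V} (hc : Cyc D.Adj (Fintype.card V) c) :
    D.IsHamiltonianCycle {p | ∃ i, p = (c i, c (i + 1))} := by
  have hbij : Function.Bijective fun i : Fin (Fintype.card V) => c i := by
    refine (Fintype.bijective_iff_injective_and_card _).2 ⟨fun i j hij => ?_, by simp⟩
    exact Fin.ext (hc.inj _ i.2 _ j.2 hij)
  have hrot : ∀ i : Fin (Fintype.card V), c (finRotate _ i : Fin _) = c ((i : ℕ) + 1) := by
    intro i
    have := i.neZero
    rw [finRotate_apply, hc.eq_iff, Fin.val_add]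
    simp
  refine ⟨Equiv.ofBijective _ hbij, fun i => ?_, ?_⟩
  · simp only [Equiv.ofBijective_apply, hrot]
    exact hc.adj i
  · ext p
    simp only [Equiv.ofBijective_apply, hrot, Set.mem_range]
    constructor
    · rintro ⟨i, rfl⟩
      refine ⟨⟨i % Fintype.card V, Nat.mod_lt _ hc.pos⟩, ?_⟩
      have e : c (i % Fintype.card V + 1) = c (i + 1) := by rw [hc.eq_iff]; simp
      simp only [hc.mod, e]
    · rintro ⟨i, rfl⟩
      exact ⟨i, rfl⟩

end ArcDisjoint

theorem mainTheorem4 {V : Type*} [Fintype V] (D : Digraph V)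
    (hloopless : ∀ u : V, ¬ D.Adj u u)
    (hn : 2 < Fintype.card V)
    (hconn : D.IsStronglyConnected)
    (hout : ∀ u : V, (Fintype.card V : ℚ) / 2 < (D.outDeg u : ℚ))
    (hin : ∀ u : V, (Fintype.card V : ℚ) / 2 < (D.inDeg u : ℚ)) :
    ∃ L₁ L₂ : Set (V × V),
      D.IsHamiltonianCycle L₁ ∧ D.IsHamiltonianCycle L₂ ∧ Disjoint L₁ L₂ := by
  have ho : ∀ u, D.outDeg u = (ArcDisjoint.outN D.Adj u).card := by
    intro u
    rw [Digraph.outDeg, ← Set.ncard_coe_finset]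
    congr 1
    ext v
    simp
  have hi : ∀ u, D.inDeg u = (ArcDisjoint.inN D.Adj u).card := by
    intro u
    rw [Digraph.inDeg, ← Set.ncard_coe_finset]
    congr 1
    ext v
    simp
  obtain ⟨c, d, hc, hd, hcd⟩ := ArcDisjoint.hasPair (r := D.Adj) hloopless hn
    (fun u => by
      have := hout u
      rw [ho, div_lt_iff₀ (by norm_num)] at this
      have h2 : Fintype.card V < (ArcDisjoint.outN D.Adj u).card * 2 := by exact_mod_cast this
      omega)
    (fun u => by
      have := hin u
      rw [hi, div_lt_iff₀ (by norm_num)] at this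
      have h2 : Fintype.card V < (ArcDisjoint.inN D.Adj u).card * 2 := by exact_mod_cast this
      omega)
  refine ⟨_, _, ArcDisjoint.isHamiltonianCycle_of_cyc hc, ArcDisjoint.isHamiltonianCycle_of_cyc hd,
    ?_⟩
  rw [Set.disjoint_left]
  rintro p ⟨i, rfl⟩ ⟨j, hj⟩
  rw [Prod.mk.injEq] at hj
  exact hcd i j hj.1 hj.2
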